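/- Work throughout either with smooth real manifolds and smooth maps, or with complex manifolds and holomorphic maps; manifolds are Hausdorff, second countable and of constant finite dimension, submanifolds are embedded, and "smooth" means holomorphic (and "diffeomorphism" means biholomorphism) in the complex case. Let $\Gamma\rightrightarrows M$ be a Lie groupoid with source $s$ and target $t$ (surjective submersions); the product $\gamma\gamma'$ is defined when $t(\gamma)=s(\gamma')$, and then $s(\gamma\gamma')=s(\gamma)$, $t(\gamma\gamma')=t(\gamma')$. The orbit of $x\in M$ is $F_x=t(s^{-1}(x))$. Let $\mathcal S\subset M$ be a $\Gamma$-stable embedded submanifold, i.e. $t(\gamma)\in\mathcal S\Leftrightarrow s(\gamma)\in\mathcal S$ for all $\gamma\in\Gamma$. Let $R\rightrightarrows L$ be a Lie subgroupoid of $\Gamma\rightrightarrows M$: $R\subset\Gamma$ and $L\subset M$ are embedded submanifolds stable under the structural maps, and $R\rightrightarrows L$ is itself a Lie groupoid (its source and target maps $R\to L$ are submersions). Assume that it is closed, i.e. $R$ is a closed subset of $\Gamma_L^L=s^{-1}(L)\cap t^{-1}(L)$, and that it is full in $\mathcal S$, which means: (a) $L\cap\mathcal S$ is dense in $L$; (b)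 $T_m\mathcal S=T_mF_m+T_mL$ for all $m\in L\cap\mathcal S$; (c) $L$ meets every $\Gamma$-orbit contained in $\mathcal S$; (d) every $\gamma\in\Gamma$ with $s(\gamma),t(\gamma)\in L\cap\mathcal S$ belongs to $R$. Let $\Gamma_L=s^{-1}(L)$, an embedded submanifold of $\Gamma$, on which $R$ acts on the left by multiplication, and let $p:\Gamma_L\to Z(R)=R\backslash\Gamma_L$ be the projection onto the quotient topological space. Then: 1. $Z(R)$ is a manifold: it carries, on its quotient topology, a manifold structure for which $p$ is a submersion. 2. There is a unique map $\phi:Z(R)\to M$ with $\phi\circ p=t|_{\Gamma_L}$. It is smooth and takes values in the closure $\overline{\mathcal S}$ of $\mathcal S$ in $M$. 3. $(Z(R),\phi)$ is a $\Gamma$-equivariant resolution of $\overline{\mathcal S}$. That is, $\phi^{-1}(\mathcal S)$ is dense in $Z(R)$ (and open); $\phi$ restricts to a diffeomorphism $\phi^{-1}(\mathcal S)\to\mathcal S$; and $(Z(R),\phi)$ admits a structure of right $\Gamma$-module, i.e. a smooth map $(z,\gamma)\mapsto z\cdot\gamma$ from $\{(z,\gamma)\in Z(R)\times\Gamma:\phi(z)=s(\gamma)\}$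 to $Z(R)$ with $\phi(z\cdot\gamma)=t(\gamma)$, $z\cdot 1_{\phi(z)}=z$ and $z\cdot(\gamma\gamma')=(z\cdot\gamma)\cdot\gamma'$ whenever $\phi(z)=s(\gamma)$ and $t(\gamma)=s(\gamma')$. 4. If $R$ is surjective in $\overline{\mathcal S}$, i.e. $L$ meets every $\Gamma$-orbit contained in $\overline{\mathcal S}$, then the resolution is surjective: $\phi(Z(R))=\overline{\mathcal S}$. 5. If $R$ is proper, i.e. for every compact $K\subset\overline{\mathcal S}$ the quotient topological space $R\backslash(\Gamma_L\cap t^{-1}(K))$ is compact, then the resolution is proper: $\phi:Z(R)\to M$ is a proper map. -/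

import Mathlib

open Set Topology
open scoped Manifold ContDiff

noncomputable section

/-- The model space `𝕜ⁿ` of `n`-dimensional manifolds over `𝕜 = ℝ` or `𝕜 = ℂ`. -/
abbrev Model (𝕜 : Type) [RCLike 𝕜] (n : ℕ) : Type := EuclideanSpace 𝕜 (Fin n)

/-- The (boundaryless) model of `n`-dimensional manifolds over `𝕜`. -/
abbrev mdl (𝕜 : Type) [RCLike 𝕜] (n : ℕ) : ModelWithCorners 𝕜 (Model 𝕜 n) (Model 𝕜 n) :=
  modelWithCornersSelf 𝕜 (Model 𝕜 n)

/-- `X` is an `n`-dimensional manifold over `𝕜`: Hausdorff, second countable, with an atlas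
whose transition maps are `C^∞` over `𝕜`. So these are smooth manifolds for `𝕜 = ℝ` and complex
manifolds for `𝕜 = ℂ`; likewise, "smooth" always means `C^∞` over `𝕜`, that is, holomorphic when
`𝕜 = ℂ`. -/
class IsMfld (𝕜 : Type) [RCLike 𝕜] (n : ℕ) (X : Type*) [TopologicalSpace X]
    [ChartedSpace (Model 𝕜 n) X] : Prop where
  isManifold : IsManifold (mdl 𝕜 n) ∞ X
  t2 : T2Space X
  secondCountable : SecondCountableTopology X

/-- An embedded submanifold of `N`: a subset `carrier` with a manifold structure, compatible with
the subspace topology, for which the inclusion is a smooth embedding. -/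
structure EmbeddedSubmanifold (𝕜 : Type) [RCLike 𝕜] (n : ℕ) (N : Type*) [TopologicalSpace N]
    [ChartedSpace (Model 𝕜 n) N] where
  carrier : Set N
  dim : ℕ
  charted : ChartedSpace (Model 𝕜 dim) carrier
  isManifold : IsManifold (mdl 𝕜 dim) ∞ carrier
  isSmoothEmbedding :
    Manifold.IsSmoothEmbedding (mdl 𝕜 dim) (mdl 𝕜 n) ∞ (Subtype.val : carrier → N)

attribute [instance] EmbeddedSubmanifold.charted EmbeddedSubmanifold.isManifold

/-- The tangent space `T_x A ⊆ T_x N` of an embedded submanifold `A` of `N`. -/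
def EmbeddedSubmanifold.tangent {𝕜 : Type} [RCLike 𝕜] {n : ℕ} {N : Type*} [TopologicalSpace N]
    [ChartedSpace (Model 𝕜 n) N] (A : EmbeddedSubmanifold 𝕜 n N) (x : A.carrier) :
    Submodule 𝕜 (TangentSpace (mdl 𝕜 n) (x : N)) :=
  LinearMap.range (mfderiv (mdl 𝕜 A.dim) (mdl 𝕜 n) (Subtype.val : A.carrier → N) x).toLinearMap

/-- A Lie groupoid `Γ ⇉ M`. The product `mul γ γ'` is meaningful when `tgt γ = src γ'` only: its
other values are arbitrary and are never used. The set of composable pairs is an embedded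
submanifold of `Γ × Γ`, so smoothness of the product there is smoothness on that set. -/
structure LieGroupoid (𝕜 : Type) [RCLike 𝕜] (g m : ℕ) (Γ M : Type*)
    [TopologicalSpace Γ] [ChartedSpace (Model 𝕜 g) Γ]
    [TopologicalSpace M] [ChartedSpace (Model 𝕜 m) M] where
  src : Γ → M
  tgt : Γ → M
  one : M → Γ
  inv : Γ → Γ
  mul : Γ → Γ → Γ
  src_one : ∀ x, src (one x) = x
  tgt_one : ∀ x, tgt (one x) = x
  src_inv : ∀ γ, src (inv γ) = tgt γ
  tgt_inv : ∀ γ, tgt (inv γ) = src γ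
  src_mul : ∀ γ γ', tgt γ = src γ' → src (mul γ γ') = src γ
  tgt_mul : ∀ γ γ', tgt γ = src γ' → tgt (mul γ γ') = tgt γ'
  mul_assoc : ∀ γ₁ γ₂ γ₃, tgt γ₁ = src γ₂ → tgt γ₂ = src γ₃ →
    mul (mul γ₁ γ₂) γ₃ = mul γ₁ (mul γ₂ γ₃)
  one_mul : ∀ γ, mul (one (src γ)) γ = γ
  mul_one : ∀ γ, mul γ (one (tgt γ)) = γ
  mul_inv : ∀ γ, mul γ (inv γ) = one (src γ)
  inv_mul : ∀ γ, mul (inv γ) γ = one (tgt γ)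
  src_submersion : Manifold.IsSubmersion (mdl 𝕜 g) (mdl 𝕜 m) ∞ src
  tgt_submersion : Manifold.IsSubmersion (mdl 𝕜 g) (mdl 𝕜 m) ∞ tgt
  smooth_one : ContMDiff (mdl 𝕜 m) (mdl 𝕜 g) ∞ one
  smooth_inv : ContMDiff (mdl 𝕜 g) (mdl 𝕜 g) ∞ inv
  smooth_mul : ContMDiffOn ((mdl 𝕜 g).prod (mdl 𝕜 g)) (mdl 𝕜 g) ∞
    (fun p : Γ × Γ => mul p.1 p.2) {p | tgt p.1 = src p.2}

section Groupoid

variable {𝕜 : Type} [RCLike 𝕜] {g m : ℕ} {Γ M : Type*}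
  [TopologicalSpace Γ] [ChartedSpace (Model 𝕜 g) Γ]
  [TopologicalSpace M] [ChartedSpace (Model 𝕜 m) M]

namespace LieGroupoid

/-- The orbit of `x`: the points `tgt γ` for arrows `γ` with `src γ = x`. -/
def orbit (G : LieGroupoid 𝕜 g m Γ M) (x : M) : Set M := G.tgt '' (G.src ⁻¹' {x})

/-- The tangent space at `x` of the orbit through `x`. The orbit is the image of the constant rank
map `tgt : src⁻¹(x) → M`, so this is the image of `ker (d src)` under `d tgt` at the unit of `x`,
i.e. the image of the anchor of the Lie algebroid at `x`. -/
def orbitTangent (G : LieGroupoid 𝕜 g m Γ M) (x : M) :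
    Submodule 𝕜 (TangentSpace (mdl 𝕜 m) x) :=
  Submodule.map (mfderiv (mdl 𝕜 g) (mdl 𝕜 m) G.tgt (G.one x)).toLinearMap
    (LinearMap.ker (mfderiv (mdl 𝕜 g) (mdl 𝕜 m) G.src (G.one x)).toLinearMap)

/-- `S` is `Γ`-stable. -/
def IsStable (G : LieGroupoid 𝕜 g m Γ M) (S : Set M) : Prop :=
  ∀ γ, G.tgt γ ∈ S ↔ G.src γ ∈ S

/-- A right `Γ`-module structure on a manifold `Z` with smooth map `φ : Z → M`. The value `act z γ`
is meaningful when `φ z = src γ` only: the others are arbitrary and are never used. The fibre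
product `{(z, γ) | φ z = src γ}` is an embedded submanifold of `Z × Γ`, so smoothness of the action
is smoothness on that set. -/
structure RightModule (G : LieGroupoid 𝕜 g m Γ M) (d : ℕ) {Z : Type*} [TopologicalSpace Z]
    [ChartedSpace (Model 𝕜 d) Z] (φ : Z → M) where
  act : Z → Γ → Z
  smooth_map : ContMDiff (mdl 𝕜 d) (mdl 𝕜 m) ∞ φ
  map_act : ∀ z γ, φ z = G.src γ → φ (act z γ) = G.tgt γ
  act_one : ∀ z, act z (G.one (φ z)) = z
  act_mul : ∀ z γ γ', φ z = G.src γ → G.tgt γ = G.src γ' →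
    act z (G.mul γ γ') = act (act z γ) γ'
  smooth_act : ContMDiffOn ((mdl 𝕜 d).prod (mdl 𝕜 g)) (mdl 𝕜 d) ∞
    (fun p : Z × Γ => act p.1 p.2) {p | φ p.1 = G.src p.2}

end LieGroupoid

/-- `(Z, φ)` is a resolution of the closure of the embedded submanifold `S`: `φ : Z → M` is smooth,
`φ⁻¹(S)` is dense in `Z`, and `φ` restricts to a diffeomorphism from `φ⁻¹(S)` to `S`.
(That `φ⁻¹(S)` is open follows, since `S` is open in its closure and density of `φ⁻¹(S)` makes `φ`
take values in that closure; it is listed to name the manifold `φ⁻¹(S)`.) -/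
structure IsResolution (S : EmbeddedSubmanifold 𝕜 m M) (d : ℕ) {Z : Type*} [TopologicalSpace Z]
    [ChartedSpace (Model 𝕜 d) Z] (φ : Z → M) : Prop where
  smooth : ContMDiff (mdl 𝕜 d) (mdl 𝕜 m) ∞ φ
  dense : Dense (φ ⁻¹' S.carrier)
  isOpen : IsOpen (φ ⁻¹' S.carrier)
  diffeo : ∃ e : Diffeomorph (mdl 𝕜 d) (mdl 𝕜 S.dim)
      (⟨φ ⁻¹' S.carrier, isOpen⟩ : TopologicalSpace.Opens Z) S.carrier ∞,
    ∀ z, (e z : M) = φ z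

/-- `(Z, φ)` is an equivariant resolution of the closure of `S`: it is a resolution and admits a
structure of right `Γ`-module. -/
def IsEquivariantResolution (G : LieGroupoid 𝕜 g m Γ M) (S : EmbeddedSubmanifold 𝕜 m M) (d : ℕ)
    {Z : Type*} [TopologicalSpace Z] [ChartedSpace (Model 𝕜 d) Z] (φ : Z → M) : Prop :=
  IsResolution S d φ ∧ Nonempty (G.RightModule d φ)

/-- A Lie subgroupoid `R ⇉ L` of `Γ ⇉ M`: embedded submanifolds `R` of `Γ` and `L` of `M`, stable
under the structural maps, such that `R ⇉ L` is itself a Lie groupoid, i.e. its source and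
target maps `R → L` are submersions. -/
structure LieSubgroupoid (G : LieGroupoid 𝕜 g m Γ M) where
  arrows : EmbeddedSubmanifold 𝕜 g Γ
  objects : EmbeddedSubmanifold 𝕜 m M
  src_mem : ∀ r ∈ arrows.carrier, G.src r ∈ objects.carrier
  tgt_mem : ∀ r ∈ arrows.carrier, G.tgt r ∈ objects.carrier
  one_mem : ∀ x ∈ objects.carrier, G.one x ∈ arrows.carrier
  inv_mem : ∀ r ∈ arrows.carrier, G.inv r ∈ arrows.carrier
  mul_mem : ∀ r ∈ arrows.carrier, ∀ r' ∈ arrows.carrier, G.tgt r = G.src r' →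
    G.mul r r' ∈ arrows.carrier
  src_submersion : Manifold.IsSubmersion (mdl 𝕜 arrows.dim) (mdl 𝕜 objects.dim) ∞
    (fun r : arrows.carrier => (⟨G.src r, src_mem r r.2⟩ : objects.carrier))
  tgt_submersion : Manifold.IsSubmersion (mdl 𝕜 arrows.dim) (mdl 𝕜 objects.dim) ∞
    (fun r : arrows.carrier => (⟨G.tgt r, tgt_mem r r.2⟩ : objects.carrier))

namespace LieSubgroupoid

variable {G : LieGroupoid 𝕜 g m Γ M}

/-- The set `Γ_L = src⁻¹(L)`, on which `R` acts from the left. -/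
def bundle (R : LieSubgroupoid G) : Set Γ := G.src ⁻¹' R.objects.carrier

/-- The relation whose classes are the orbits of the left action of `R` on `Γ_L`. -/
def orbitSetoid (R : LieSubgroupoid G) : Setoid R.bundle where
  r γ γ' := ∃ r ∈ R.arrows.carrier, G.tgt r = G.src γ'.1 ∧ γ.1 = G.mul r γ'.1
  iseqv :=
    { refl := fun γ => ⟨G.one (G.src γ.1), R.one_mem _ γ.2, G.tgt_one _, (G.one_mul _).symm⟩
      symm := by
        rintro γ γ' ⟨r, hr, h, e⟩
        refine ⟨G.inv r, R.inv_mem r hr, ?_, ?_⟩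
        · rw [G.tgt_inv, e, G.src_mul _ _ h]
        · rw [e, ← G.mul_assoc _ _ _ (G.tgt_inv r) h, G.inv_mul, h, G.one_mul]
      trans := by
        rintro γ γ' γ'' ⟨r, hr, h, e⟩ ⟨r', hr', h', e'⟩
        have hc : G.tgt r = G.src r' := by rw [h, e', G.src_mul _ _ h']
        refine ⟨G.mul r r', R.mul_mem r hr r' hr' hc, ?_, ?_⟩
        · rw [G.tgt_mul _ _ hc, h']
        · rw [e, e', G.mul_assoc _ _ _ hc h'] }

/-- The topological space `Z(R) = R \ Γ_L` (with the quotient topology). -/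
abbrev Z (R : LieSubgroupoid G) : Type _ := Quotient R.orbitSetoid

/-- The canonical projection `Γ_L → Z(R)`. -/
def proj (R : LieSubgroupoid G) (γ : R.bundle) : R.Z := Quotient.mk R.orbitSetoid γ

/-- `R ⇉ L` is closed: `R` is a closed subset of `Γ_L^L = {γ | src γ ∈ L, tgt γ ∈ L}`. -/
def IsClosed (R : LieSubgroupoid G) : Prop :=
  _root_.IsClosed (Subtype.val ⁻¹' R.arrows.carrier :
    Set {γ : Γ // G.src γ ∈ R.objects.carrier ∧ G.tgt γ ∈ R.objects.carrier})

/-- `R ⇉ L` is a Lie subgroupoid in `S`: `L ∩ S` is dense in `L`, `L` intersects transversally the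
orbits contained in `S`, and `L` meets all of these orbits. -/
structure IsIn (R : LieSubgroupoid G) (S : EmbeddedSubmanifold 𝕜 m M) : Prop where
  dense : Dense (Subtype.val ⁻¹' S.carrier : Set R.objects.carrier)
  transverse : ∀ (x : M) (hL : x ∈ R.objects.carrier) (hS : x ∈ S.carrier),
    S.tangent ⟨x, hS⟩ = G.orbitTangent x ⊔ R.objects.tangent ⟨x, hL⟩
  meets : ∀ x, G.orbit x ⊆ S.carrier → (R.objects.carrier ∩ G.orbit x).Nonempty

/-- `R ⇉ L` is full in `S`: it is in `S`, and every arrow of `Γ` connecting two points of `L ∩ S`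
belongs to `R`. -/
structure IsFullIn (R : LieSubgroupoid G) (S : EmbeddedSubmanifold 𝕜 m M) : Prop where
  isIn : R.IsIn S
  full : ∀ γ : Γ, G.src γ ∈ R.objects.carrier ∩ S.carrier →
    G.tgt γ ∈ R.objects.carrier ∩ S.carrier → γ ∈ R.arrows.carrier

/-- `R ⇉ L` is surjective in the closure of `S`: `L` meets every orbit contained in it. -/
def IsSurjectiveIn (R : LieSubgroupoid G) (S : EmbeddedSubmanifold 𝕜 m M) : Prop :=
  ∀ x, G.orbit x ⊆ closure S.carrier → (R.objects.carrier ∩ G.orbit x).Nonempty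

/-- The orbit relation of the left action of `R` on `Γ_L^K = {γ ∈ Γ_L | tgt γ ∈ K}`. -/
def orbitSetoidOver (R : LieSubgroupoid G) (K : Set M) :
    Setoid {γ : R.bundle // G.tgt γ.1 ∈ K} :=
  R.orbitSetoid.comap Subtype.val

/-- `R ⇉ L` is proper: for every compact `K ⊆ closure S`, the quotient space `R \ Γ_L^K` is
compact. -/
def IsProperIn (R : LieSubgroupoid G) (S : EmbeddedSubmanifold 𝕜 m M) : Prop :=
  ∀ K : Set M, IsCompact K → K ⊆ closure S.carrier →
    CompactSpace (Quotient (R.orbitSetoidOver K))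

end LieSubgroupoid

end Groupoid

end

/-! Two elements of `Γ_L` lie in the same `R`-orbit exactly when they have the same target and the
quotient `γγ'⁻¹` belongs to `R`; in particular the action is free. Godement's criterion makes the
orbit space a manifold. Near `γ`, choose a slice `σ` transverse to the orbit and move it by the
arrows of `R` close to units: this is a local diffeomorphism by the inverse function theorem, and
its plaques are the local traces of the orbits, because equivalent points close to `γ` differ by an
arrow close to a unit (`isFoliatedAt_proj`). Plaque charts at different points of one orbit are
compared by left multiplication with a local section of the target of `R` (`exists_transport`), and
`exists_quotient_manifold` glues them. Closedness of `R` makes the orbit relation closed, so the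
quotient is Hausdorff (`isClosed_proj_eq`).

The target descends to `φ`, and right multiplication descends because it commutes with the left
action. The set `φ⁻¹(S)` pulls back to the arrows with source in `L ∩ S`. It is open since `S` is
open in its closure, which contains `L`, and dense since the source map is open. Over `S`, fullness
gives injectivity of `φ` (`phi_injOn`), and the fact that `L` meets every orbit gives surjectivity.
Transversality says that the target of arrows starting in `L ∩ S` is submersive onto `S` at the
units, which gives smooth local sections (`exists_section_tgt`); translating them by arrows of `Γ`
yields local sections of `φ` over all of `S` (`exists_section_phi`). By injectivity they coincide
with the inverse of `φ`, which is therefore smooth.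

Local arguments use `ContMDiffNear` because `ContMDiffAt` at order `∞` only gives, for each finite
order, a neighbourhood depending on that order. -/

noncomputable section

/-! ### Smoothness on a neighbourhood of a point. -/

section Near

variable {𝕜 : Type*} [NontriviallyNormedField 𝕜]
  {E E' E'' : Type*} [NormedAddCommGroup E] [NormedSpace 𝕜 E] [NormedAddCommGroup E']
  [NormedSpace 𝕜 E'] [NormedAddCommGroup E''] [NormedSpace 𝕜 E'']
  {H H' H'' : Type*} [TopologicalSpace H] [TopologicalSpace H'] [TopologicalSpace H'']
  {I : ModelWithCorners 𝕜 E H} {I' : ModelWithCorners 𝕜 E' H'} {I'' : ModelWithCorners 𝕜 E'' H''}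
  {X Y Z : Type*} [TopologicalSpace X] [ChartedSpace H X] [TopologicalSpace Y] [ChartedSpace H' Y]
  [TopologicalSpace Z] [ChartedSpace H'' Z]

variable (I I') in
/-- `f` is smooth on a neighbourhood of `x`. -/
def ContMDiffNear (f : X → Y) (x : X) : Prop := ∀ᶠ y in 𝓝 x, ContMDiffAt I I' ∞ f y

namespace ContMDiffNear

theorem contMDiffAt {f : X → Y} {x : X} (h : ContMDiffNear I I' f x) : ContMDiffAt I I' ∞ f x :=
  h.self_of_nhds

theorem continuousAt {f : X → Y} {x : X} (h : ContMDiffNear I I' f x) : ContinuousAt f x :=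
  h.contMDiffAt.continuousAt

theorem mdifferentiableAt {f : X → Y} {x : X} (h : ContMDiffNear I I' f x) :
    MDifferentiableAt I I' f x :=
  h.contMDiffAt.mdifferentiableAt (by simp)

theorem comp {g : Y → Z} {f : X → Y} {x : X} (hg : ContMDiffNear I' I'' g (f x))
    (hf : ContMDiffNear I I' f x) : ContMDiffNear I I'' (fun z => g (f z)) x := by
  filter_upwards [hf, hf.continuousAt.eventually hg] with y h1 h2
  exact ContMDiffAt.comp y h2 h1

theorem comp_of_eq {g : Y → Z} {f : X → Y} {x : X} {y : Y} (hg : ContMDiffNear I' I'' g y)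
    (hf : ContMDiffNear I I' f x) (h : f x = y) : ContMDiffNear I I'' (fun z => g (f z)) x := by
  subst h; exact hg.comp hf

theorem prodMk {g : X → Z} {f : X → Y} {x : X} (hf : ContMDiffNear I I' f x)
    (hg : ContMDiffNear I I'' g x) : ContMDiffNear I (I'.prod I'') (fun z => (f z, g z)) x := by
  filter_upwards [hf, hg] with y h1 h2
  exact h1.prodMk h2

theorem congr {f g : X → Y} {x : X} (hf : ContMDiffNear I I' f x) (h : f =ᶠ[𝓝 x] g) :
    ContMDiffNear I I' g x := by
  filter_upwards [hf, h.eventually_nhds] with y h1 h2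
  exact h1.congr_of_eventuallyEq (Filter.EventuallyEq.symm h2)

theorem of_mem_maximalAtlas {e : OpenPartialHomeomorph X H} {x : X}
    (h : e ∈ IsManifold.maximalAtlas I ∞ X) (hx : x ∈ e.source) : ContMDiffNear I I e x := by
  filter_upwards [e.open_source.mem_nhds hx] with y hy
  exact contMDiffAt_of_mem_maximalAtlas h hy

theorem of_symm_mem_maximalAtlas {e : OpenPartialHomeomorph X H} {x : H}
    (h : e ∈ IsManifold.maximalAtlas I ∞ X) (hx : x ∈ e.target) : ContMDiffNear I I e.symm x := by
  filter_upwards [e.open_target.mem_nhds hx] with y hy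
  exact contMDiffAt_symm_of_mem_maximalAtlas h hy

theorem id {x : X} : ContMDiffNear I I (fun y : X => y) x :=
  Filter.Eventually.of_forall fun _ => contMDiffAt_id

theorem const {x : X} {c : Y} : ContMDiffNear I I' (fun _ : X => c) x :=
  Filter.Eventually.of_forall fun _ => contMDiffAt_const

end ContMDiffNear

theorem ContMDiff.contMDiffNear {f : X → Y} (h : ContMDiff I I' ∞ f) (x : X) :
    ContMDiffNear I I' f x := Filter.Eventually.of_forall fun y => h y

theorem ContDiff.contMDiffNear {f : E → E'} (h : ContDiff 𝕜 ∞ f) (x : E) :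
    ContMDiffNear 𝓘(𝕜, E) 𝓘(𝕜, E') f x := h.contMDiff.contMDiffNear x

end Near

variable {𝕜 : Type} [RCLike 𝕜]

/-! ### Complements in the model spaces. -/

section LinearAlgebra

theorem ContinuousLinearEquiv.nonempty_model {V : Type*} [NormedAddCommGroup V] [NormedSpace 𝕜 V]
    [FiniteDimensional 𝕜 V] {k : ℕ} (h : Module.finrank 𝕜 V = k) : Nonempty (V ≃L[𝕜] Model 𝕜 k) :=
  ⟨ContinuousLinearEquiv.ofFinrankEq (by simp [h])⟩

/-- A complement of `Model 𝕜 b` in `Model 𝕜 a` is isomorphic to `Model 𝕜 (a - b)`. -/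
theorem exists_complement_model {F : Type*} [NormedAddCommGroup F] [NormedSpace 𝕜 F]
    {a b : ℕ} (e : Model 𝕜 a ≃L[𝕜] Model 𝕜 b × F) :
    b + (a - b) = a ∧ Nonempty (F ≃L[𝕜] Model 𝕜 (a - b)) := by
  have hF : FiniteDimensional 𝕜 F :=
    Module.Finite.of_surjective ((LinearMap.snd 𝕜 (Model 𝕜 b) F) ∘ₗ e.toLinearMap)
      (Prod.snd_surjective.comp e.surjective)
  have := e.toLinearEquiv.finrank_eq
  simp only [finrank_euclideanSpace, Fintype.card_fin, Module.finrank_prod] at this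
  exact ⟨by omega, ContinuousLinearEquiv.nonempty_model (by omega)⟩

end LinearAlgebra

/-! ### Normal form and local sections of submersions. -/

section Submersion

variable {a b : ℕ} {X Y : Type*} [TopologicalSpace X] [ChartedSpace (Model 𝕜 a) X]
  [TopologicalSpace Y] [ChartedSpace (Model 𝕜 b) Y]

/-- A dimension count determines the complement up to isomorphism, so the one hidden in the
definition can be traded for a fixed model, the same at every point. -/
theorem Manifold.IsSubmersionAt.model_complement {f : X → Y} {x : X}
    (h : Manifold.IsSubmersionAt (mdl 𝕜 a) (mdl 𝕜 b) ∞ f x) :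
    b + (a - b) = a ∧
      Manifold.IsSubmersionAtOfComplement (Model 𝕜 (a - b)) (mdl 𝕜 a) (mdl 𝕜 b) ∞ f x := by
  obtain ⟨F, _, _, hF⟩ := h
  obtain ⟨h1, ⟨e⟩⟩ := exists_complement_model hF.equiv
  exact ⟨h1, hF.trans_F e⟩

/-- The normal form of a submersion in charts. -/
theorem Manifold.IsSubmersionAtOfComplement.exists_charts {F : Type*} [NormedAddCommGroup F]
    [NormedSpace 𝕜 F] {f : X → Y} {x : X}
    (h : Manifold.IsSubmersionAtOfComplement F (mdl 𝕜 a) (mdl 𝕜 b) ∞ f x) :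
    ∃ φ ∈ IsManifold.maximalAtlas (mdl 𝕜 a) ∞ X, ∃ ψ ∈ IsManifold.maximalAtlas (mdl 𝕜 b) ∞ Y,
      ∃ e : Model 𝕜 a ≃L[𝕜] Model 𝕜 b × F, x ∈ φ.source ∧ MapsTo f φ.source ψ.source ∧
        ∀ y ∈ φ.source, ψ (f y) = (e (φ y)).1 := by
  refine ⟨h.domChart, h.domChart_mem_maximalAtlas, h.codChart, h.codChart_mem_maximalAtlas,
    h.equiv, h.mem_domChart_source, h.mapsto_domChart_source_codChart_source, fun y hy => ?_⟩
  have hu : h.domChart y ∈ (h.domChart.extend (mdl 𝕜 a)).target := by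
    simpa using h.domChart.map_source hy
  have := h.writtenInCharts hu
  simpa [h.domChart.left_inv hy] using this

/-- Near a point of its domain, a submersion `f : X → Y` identifies `X` with `Y × F`. -/
theorem Manifold.IsSubmersionAtOfComplement.exists_param {F : Type*} [NormedAddCommGroup F]
    [NormedSpace 𝕜 F] {f : X → Y} {x : X}
    (h : Manifold.IsSubmersionAtOfComplement F (mdl 𝕜 a) (mdl 𝕜 b) ∞ f x) :
    ∃ (ρ : Y × F → X) (κ : X → F),
      ContMDiffNear ((mdl 𝕜 b).prod 𝓘(𝕜, F)) (mdl 𝕜 a) ρ (f x, κ x) ∧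
      ContMDiffNear (mdl 𝕜 a) 𝓘(𝕜, F) κ x ∧
      (∀ᶠ y in 𝓝 x, ρ (f y, κ y) = y) ∧
      ∀ᶠ p in 𝓝 (f x, κ x), f (ρ p) = p.1 ∧ κ (ρ p) = p.2 := by
  obtain ⟨φ, hφ, ψ, hψ, e, hx, hm, hw⟩ := h.exists_charts
  have hκ : ContMDiffNear (mdl 𝕜 a) 𝓘(𝕜, F) (fun y => (e (φ y)).2) x :=
    ContMDiffNear.comp (I' := mdl 𝕜 a) (g := fun u => (e u).2)
      ((contDiff_snd.comp e.contDiff).contMDiffNear _) (.of_mem_maximalAtlas hφ hx)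
  have hin : ContMDiffNear ((mdl 𝕜 b).prod 𝓘(𝕜, F)) (mdl 𝕜 a)
      (fun p : Y × F => e.symm (ψ p.1, p.2)) (f x, (e (φ x)).2) := by
    have h1 : ContMDiffNear ((mdl 𝕜 b).prod 𝓘(𝕜, F)) (mdl 𝕜 b)
        (fun p : Y × F => ψ p.1) (f x, (e (φ x)).2) :=
      ContMDiffNear.comp (f := Prod.fst) (.of_mem_maximalAtlas hψ (hm hx))
        (contMDiff_fst.contMDiffNear _)
    have h2 : ContMDiffNear ((mdl 𝕜 b).prod 𝓘(𝕜, F)) 𝓘(𝕜, F)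
        (fun p : Y × F => p.2) (f x, (e (φ x)).2) := contMDiff_snd.contMDiffNear _
    filter_upwards [h1, h2] with p hp1 hp2
    exact e.symm.contDiff.contMDiff.contMDiffAt.comp p (hp1.prodMk_space hp2)
  have hin0 : e.symm (ψ (f x), (e (φ x)).2) = φ x := by
    rw [hw x hx, Prod.mk.eta, e.symm_apply_apply]
  -- In the charts `f` is the first component of `e`; the second component is `κ`, and `ρ` inverts
  -- the pair `(f, κ)`.
  refine ⟨fun p => φ.symm (e.symm (ψ p.1, p.2)), fun y => (e (φ y)).2, ?_, hκ, ?_, ?_⟩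
  · exact ContMDiffNear.comp_of_eq (.of_symm_mem_maximalAtlas hφ (φ.map_source hx)) hin hin0
  · filter_upwards [φ.open_source.mem_nhds hx] with y hy
    rw [hw y hy, Prod.mk.eta, e.symm_apply_apply, φ.left_inv hy]
  · have hc : ContinuousAt (fun p : Y × F => e.symm (ψ p.1, p.2)) (f x, (e (φ x)).2) :=
      hin.continuousAt
    have h1 : ContinuousAt (Prod.fst : Y × F → Y) (f x, (e (φ x)).2) := continuousAt_fst
    have h0 : φ.target ∈ 𝓝 (e.symm (ψ (f x), (e (φ x)).2)) := by
      rw [hin0]; exact φ.open_target.mem_nhds (φ.map_source hx)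
    filter_upwards [hc.eventually h0,
      h1.eventually (ψ.open_source.mem_nhds (hm hx))] with p hp hp1
    have hp' := φ.map_target hp
    have := hw _ hp'
    rw [φ.right_inv hp, e.apply_symm_apply] at this
    exact ⟨ψ.injOn (hm hp') hp1 this, by rw [φ.right_inv hp, e.apply_symm_apply]⟩

/-- A submersion has local sections through every point of its domain. -/
theorem Manifold.IsSubmersionAt.exists_section {f : X → Y} {x : X}
    (h : Manifold.IsSubmersionAt (mdl 𝕜 a) (mdl 𝕜 b) ∞ f x) :
    ∃ τ : Y → X, ContMDiffNear (mdl 𝕜 b) (mdl 𝕜 a) τ (f x) ∧ τ (f x) = x ∧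
      ∀ᶠ y in 𝓝 (f x), f (τ y) = y := by
  obtain ⟨F, _, _, hF⟩ := h
  obtain ⟨ρ, κ, h1, h2, h3, h4⟩ := hF.exists_param
  refine ⟨fun y => ρ (y, κ x), ContMDiffNear.comp (f := fun y => (y, κ x)) h1
      (ContMDiffNear.id.prodMk ContMDiffNear.const),
    h3.self_of_nhds, ?_⟩
  have hc : ContinuousAt (fun y : Y => (y, κ x)) (f x) := by fun_prop
  exact (hc.eventually h4).mono fun y hy => hy.1

/-- A local section through `x` carries points near `f x` back to points near `x`. -/
theorem Manifold.IsSubmersion.isOpenMap {f : X → Y}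
    (h : Manifold.IsSubmersion (mdl 𝕜 a) (mdl 𝕜 b) ∞ f) : IsOpenMap f := by
  rw [isOpenMap_iff_nhds_le]
  intro x s hs
  obtain ⟨τ, h1, h2, h3⟩ := (h.isSubmersionAt x).exists_section
  have : τ ⁻¹' (f ⁻¹' s) ∈ 𝓝 (f x) := h1.continuousAt.preimage_mem_nhds (by rwa [h2])
  filter_upwards [this, h3] with y hy hy'
  simpa [hy'] using hy

end Submersion

/-! ### Manifold structures from compatible charts. -/

section Cover

/-- A cover of `X` by charts with smooth transition maps makes `X` a manifold. -/
theorem exists_chartedSpace_of_cover {d : ℕ} {X ι : Type*} [TopologicalSpace X]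
    (c : ι → OpenPartialHomeomorph X (Model 𝕜 d)) (hc : ∀ x, ∃ i, x ∈ (c i).source)
    (ht : ∀ i j x, x ∈ (c i).source → x ∈ (c j).source →
      ContDiffAt 𝕜 ∞ (fun u => c j ((c i).symm u)) (c i x)) :
    ∃ _ : ChartedSpace (Model 𝕜 d) X, IsManifold (mdl 𝕜 d) ∞ X ∧
      ∀ i, c i ∈ IsManifold.maximalAtlas (mdl 𝕜 d) ∞ X := by
  choose f hf using hc
  let cs : ChartedSpace (Model 𝕜 d) X :=
    { atlas := range c
      chartAt := fun x => c (f x)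
      mem_chart_source := hf
      chart_mem_atlas := fun x => mem_range_self _ }
  have hm : IsManifold (mdl 𝕜 d) ∞ X := by
    refine isManifold_of_contDiffOn _ _ _ ?_
    rintro _ _ ⟨i, rfl⟩ ⟨j, rfl⟩
    intro u hu
    simp only [mfld_simps] at hu
    have := ht i j ((c i).symm u) ((c i).map_target hu.1) hu.2
    rw [(c i).right_inv hu.1] at this
    exact this.contDiffWithinAt
  exact ⟨cs, hm, fun i => IsManifold.subset_maximalAtlas (mem_range_self i)⟩

end Cover

/-! ### Embedded submanifolds as slices. -/

section Embedded

variable {k n : ℕ} {N : Type*} [TopologicalSpace N] [ChartedSpace (Model 𝕜 n) N]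

/-- The normal form of an immersion in charts. -/
theorem Manifold.IsImmersionAt.exists_charts {X : Type*} [TopologicalSpace X]
    [ChartedSpace (Model 𝕜 k) X] {f : X → N} {x : X}
    (h : Manifold.IsImmersionAt (mdl 𝕜 k) (mdl 𝕜 n) ∞ f x) :
    ∃ φ ∈ IsManifold.maximalAtlas (mdl 𝕜 k) ∞ X, ∃ ψ ∈ IsManifold.maximalAtlas (mdl 𝕜 n) ∞ N,
      ∃ e : Model 𝕜 n ≃L[𝕜] Model 𝕜 k × Model 𝕜 (n - k), x ∈ φ.source ∧
        MapsTo f φ.source ψ.source ∧ ∀ y ∈ φ.source, e (ψ (f y)) = (φ y, 0) := by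
  obtain ⟨F, _, _, hF⟩ := h
  obtain ⟨-, ⟨e⟩⟩ := exists_complement_model hF.equiv.symm
  replace hF := hF.trans_F e
  refine ⟨hF.domChart, hF.domChart_mem_maximalAtlas, hF.codChart, hF.codChart_mem_maximalAtlas,
    hF.equiv.symm, hF.mem_domChart_source, hF.source_subset_preimage_source, fun y hy => ?_⟩
  have hu : hF.domChart y ∈ (hF.domChart.extend (mdl 𝕜 k)).target := by
    simpa using hF.domChart.map_source hy
  have := hF.writtenInCharts hu
  rw [ContinuousLinearEquiv.symm_apply_eq]
  simpa [hF.domChart.left_inv hy] using this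

variable {A : Set N}

/-- Near each of its points, an embedded submanifold is a retract. -/
theorem Manifold.IsSmoothEmbedding.exists_retraction [ChartedSpace (Model 𝕜 k) A]
    (h : Manifold.IsSmoothEmbedding (mdl 𝕜 k) (mdl 𝕜 n) ∞ (Subtype.val : A → N)) (x : A) :
    ∃ r : N → A, ContMDiffNear (mdl 𝕜 n) (mdl 𝕜 k) r x ∧ ∀ᶠ y : A in 𝓝 x, r y = y := by
  obtain ⟨φ, hφ, ψ, hψ, e, hx, hm, hw⟩ := (h.isImmersion.isImmersionAt x).exists_charts
  -- Drop the transverse coordinates in an immersion chart.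
  refine ⟨fun y => φ.symm (e (ψ y)).1, ?_, ?_⟩
  · refine ContMDiffNear.comp_of_eq (.of_symm_mem_maximalAtlas hφ (φ.map_source hx))
      (ContMDiffNear.comp (I' := mdl 𝕜 n) (g := fun u => (e u).1)
        ((contDiff_fst.comp e.contDiff).contMDiffNear _) (.of_mem_maximalAtlas hψ (hm hx))) ?_
    rw [hw x hx]
  · filter_upwards [φ.open_source.mem_nhds hx] with y hy
    rw [hw y hy, φ.left_inv hy]

/-- A map into an embedded submanifold is smooth if it is smooth as a map into the ambient
manifold. -/
theorem Manifold.IsSmoothEmbedding.contMDiffWithinAt_of_val [ChartedSpace (Model 𝕜 k) A]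
    (h : Manifold.IsSmoothEmbedding (mdl 𝕜 k) (mdl 𝕜 n) ∞ (Subtype.val : A → N))
    {E H X : Type*} [NormedAddCommGroup E] [NormedSpace 𝕜 E] [TopologicalSpace H]
    {I : ModelWithCorners 𝕜 E H} [TopologicalSpace X] [ChartedSpace H X] {f : X → A} {s : Set X}
    {x : X} (hf : ContMDiffWithinAt I (mdl 𝕜 n) ∞ (fun y => (f y : N)) s x) :
    ContMDiffWithinAt I (mdl 𝕜 k) ∞ f s x := by
  obtain ⟨r, hr, hr'⟩ := h.exists_retraction (f x)
  have hc : ContinuousWithinAt f s x := by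
    rw [IsInducing.subtypeVal.continuousWithinAt_iff]
    exact hf.continuousWithinAt
  -- Near `x`, `f` equals the smooth retraction composed with the ambient version of `f`.
  refine (hr.contMDiffAt.comp_contMDiffWithinAt x hf).congr_of_eventuallyEq ?_ ?_
  · exact (hc.eventually hr').mono fun y hy => hy.symm
  · exact hr'.self_of_nhds.symm

theorem Manifold.IsSmoothEmbedding.contMDiffNear_of_val [ChartedSpace (Model 𝕜 k) A]
    (h : Manifold.IsSmoothEmbedding (mdl 𝕜 k) (mdl 𝕜 n) ∞ (Subtype.val : A → N))
    {E H X : Type*} [NormedAddCommGroup E] [NormedSpace 𝕜 E] [TopologicalSpace H]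
    {I : ModelWithCorners 𝕜 E H} [TopologicalSpace X] [ChartedSpace H X] {f : X → A} {x : X}
    (hf : ContMDiffNear I (mdl 𝕜 n) (fun y => (f y : N)) x) : ContMDiffNear I (mdl 𝕜 k) f x := by
  filter_upwards [hf] with y hy
  exact h.contMDiffWithinAt_of_val hy

variable (𝕜 n) in
/-- Near `x`, the subset `A` is a coordinate subspace of dimension `k` and codimension `c` in some
chart of `N`. -/
def IsSliceAt (k c : ℕ) (A : Set N) (x : N) : Prop :=
  ∃ Θ ∈ IsManifold.maximalAtlas (mdl 𝕜 n) ∞ N, x ∈ Θ.source ∧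
    ∃ e : Model 𝕜 n ≃L[𝕜] Model 𝕜 k × Model 𝕜 c, ∀ y ∈ Θ.source, y ∈ A ↔ (e (Θ y)).2 = 0

/-- The immersion normal form only places one sheet of `A` in the coordinate subspace. Since `A` has
the subspace topology, that sheet is the trace of an open set `W`; restricting the chart to `W`
removes the other sheets, and restricting it to points whose first coordinate lies in `φ.target`
removes the part of the subspace not reached by the sheet. -/
theorem Manifold.IsSmoothEmbedding.isSliceAt [ChartedSpace (Model 𝕜 k) A]
    (h : Manifold.IsSmoothEmbedding (mdl 𝕜 k) (mdl 𝕜 n) ∞ (Subtype.val : A → N)) {x : N}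
    (hxA : x ∈ A) : IsSliceAt 𝕜 n k (n - k) A x := by
  obtain ⟨φ, hφ, ψ, hψ, e, hx, hm, hw⟩ := (h.isImmersion.isImmersionAt ⟨x, hxA⟩).exists_charts
  obtain ⟨W, hW, hWφ⟩ := isOpen_induced_iff.1 φ.open_source
  have hO : IsOpen (ψ.source ∩ ψ ⁻¹' ((fun u => (e u).1) ⁻¹' φ.target)) :=
    ψ.isOpen_inter_preimage (φ.open_target.preimage (by fun_prop))
  refine ⟨ψ.restr (W ∩ (ψ.source ∩ ψ ⁻¹' ((fun u => (e u).1) ⁻¹' φ.target))),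
    restr_mem_maximalAtlas (contDiffGroupoid ∞ (mdl 𝕜 n)) hψ (hW.inter hO), ?_, e, ?_⟩
  · rw [OpenPartialHomeomorph.restr_source' _ _ (hW.inter hO)]
    refine ⟨hm hx, by simpa [← hWφ] using hx, hm hx, ?_⟩
    simpa [hw _ hx] using φ.map_source hx
  · intro y hy
    rw [OpenPartialHomeomorph.restr_source' _ _ (hW.inter hO)] at hy
    obtain ⟨hy1, hyW, -, hy2⟩ := hy
    rw [OpenPartialHomeomorph.restr_apply]
    constructor
    · intro hyA
      rw [hw ⟨y, hyA⟩ (by rw [← hWφ]; exact hyW)]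
    · intro hy0
      have h1 := hw _ (φ.map_target hy2)
      rw [φ.right_inv hy2] at h1
      have h2 : e (ψ y) = ((e (ψ y)).1, 0) := Prod.ext rfl hy0
      rw [← h2] at h1
      rw [← ψ.injOn (hm (φ.map_target hy2)) hy1 (e.injective h1)]
      exact Subtype.coe_prop _

/-- A subset which is a slice near each of its points is an embedded submanifold. -/
theorem exists_isSmoothEmbedding_of_isSliceAt {c : ℕ} (h : ∀ x ∈ A, IsSliceAt 𝕜 n k c A x) :
    ∃ _ : ChartedSpace (Model 𝕜 k) A, IsManifold (mdl 𝕜 k) ∞ A ∧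
      Manifold.IsSmoothEmbedding (mdl 𝕜 k) (mdl 𝕜 n) ∞ (Subtype.val : A → N) := by
  replace h : ∀ x : A, IsSliceAt 𝕜 n k c A x := fun x => h x x.2
  choose Θ hΘ hx e he using h
  have hmem : ∀ x : A, ∀ u, (e x).symm (u, 0) ∈ (Θ x).target →
      (Θ x).symm ((e x).symm (u, 0)) ∈ A := by
    intro x u hu
    rw [he x _ ((Θ x).map_target hu), (Θ x).right_inv hu, (e x).apply_symm_apply]
  have hsec : ∀ x y : A, (y : N) ∈ (Θ x).source →
      (e x).symm ((e x (Θ x y)).1, 0) = Θ x y := by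
    intro x y hy
    rw [ContinuousLinearEquiv.symm_apply_eq]
    exact Prod.ext rfl ((he x _ hy).1 y.2).symm
  classical
  -- The chart keeps the coordinates along the slice; its inverse fills in `0` transversally and
  -- lands in `A` by `hmem`, so the branch `else x` is never reached on the target.
  let ch : A → OpenPartialHomeomorph A (Model 𝕜 k) := fun x =>
    { toFun := fun y => (e x (Θ x y)).1
      invFun := fun u => if hu : (Θ x).symm ((e x).symm (u, 0)) ∈ A then ⟨_, hu⟩ else x
      source := Subtype.val ⁻¹' (Θ x).source
      target := {u | (e x).symm (u, 0) ∈ (Θ x).target}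
      map_source' := fun y hy => by
        simp only [mem_ofPred_eq]
        rw [hsec x y hy]
        exact (Θ x).map_source hy
      map_target' := fun u hu => by
        rw [dif_pos (hmem x u hu)]
        exact (Θ x).map_target hu
      left_inv' := fun y hy => by
        have : (Θ x).symm ((e x).symm ((e x (Θ x y)).1, 0)) = y := by
          rw [hsec x y hy, (Θ x).left_inv hy]
        simp [this]
      right_inv' := fun u hu => by
        rw [dif_pos (hmem x u hu)]
        simp only
        rw [(Θ x).right_inv hu, (e x).apply_symm_apply]
      open_source := (Θ x).open_source.preimage continuous_subtype_val
      open_target := (Θ x).open_target.preimage (by fun_prop)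
      continuousOn_toFun := by
        refine (continuous_fst.comp (e x).continuous).comp_continuousOn ?_
        exact (Θ x).continuousOn.comp continuous_subtype_val.continuousOn fun y hy => hy
      continuousOn_invFun := by
        rw [IsInducing.subtypeVal.continuousOn_iff]
        have h1 : ContinuousOn (fun u : Model 𝕜 k => (Θ x).symm ((e x).symm (u, 0)))
            {u | (e x).symm (u, 0) ∈ (Θ x).target} :=
          (Θ x).continuousOn_symm.comp (by fun_prop) fun u hu => hu
        refine h1.congr fun u hu => ?_
        simp [dif_pos (hmem x u hu)] }
  have hsymm : ∀ x u, u ∈ (ch x).target →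
      ((ch x).symm u : N) = (Θ x).symm ((e x).symm (u, 0)) := by
    intro x u hu
    change ((if hu : (Θ x).symm ((e x).symm (u, 0)) ∈ A then ⟨_, hu⟩ else x : A) : N) = _
    rw [dif_pos (hmem x u hu)]
  obtain ⟨cs, hman, hmax⟩ := exists_chartedSpace_of_cover ch (fun x => ⟨x, hx x⟩) (by
    intro i j y hyi hyj
    have h1 : ContMDiffAt (mdl 𝕜 k) (mdl 𝕜 k) ∞
        (fun u => (e j (Θ j ((Θ i).symm ((e i).symm (u, 0))))).1) (ch i y) := by
      have hs : (e i).symm (ch i y, 0) = Θ i y := hsec i y hyi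
      have a1 : ContMDiffAt (mdl 𝕜 k) (mdl 𝕜 n) ∞ (fun u => (e i).symm (u, (0 : Model 𝕜 c)))
          (ch i y) := by
        refine ContDiff.contMDiff ?_ |>.contMDiffAt
        fun_prop
      have a2 : ContMDiffAt (mdl 𝕜 n) (mdl 𝕜 n) ∞ (Θ i).symm ((e i).symm (ch i y, 0)) := by
        rw [hs]
        exact contMDiffAt_symm_of_mem_maximalAtlas (hΘ i) ((Θ i).map_source hyi)
      have a3 : ContMDiffAt (mdl 𝕜 n) (mdl 𝕜 n) ∞ (Θ j)
          ((Θ i).symm ((e i).symm (ch i y, 0))) := by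
        rw [hs, (Θ i).left_inv hyi]
        exact contMDiffAt_of_mem_maximalAtlas (hΘ j) hyj
      have a4 : ContMDiffAt (mdl 𝕜 n) (mdl 𝕜 k) ∞ (fun u => (e j u).1)
          (Θ j ((Θ i).symm ((e i).symm (ch i y, 0)))) := by
        refine ContDiff.contMDiff ?_ |>.contMDiffAt
        fun_prop
      exact ContMDiffAt.comp (g := fun u => (e j u).1) _ a4 (ContMDiffAt.comp (g := Θ j) _ a3
        (ContMDiffAt.comp (g := (Θ i).symm) _ a2 a1))
    refine h1.contDiffAt.congr_of_eventuallyEq ?_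
    filter_upwards [(ch i).open_target.mem_nhds ((ch i).map_source hyi)] with u hu
    change (e j (Θ j ((ch i).symm u : A))).1 = _
    rw [hsymm i u hu])
  refine ⟨cs, hman, ⟨?_, IsEmbedding.subtypeVal⟩⟩
  refine Manifold.IsImmersionOfComplement.isImmersion (F := Model 𝕜 c) fun x => ?_
  refine Manifold.IsImmersionAtOfComplement.mk_of_charts (e x).symm (ch x) (Θ x) (hx x)
    (hx x) (hmax x) (hΘ x) (fun y hy => hy) fun u hu => ?_
  have hu' : u ∈ (ch x).target := by simpa using hu
  have : (Θ x) ((ch x).symm u) = (e x).symm (u, 0) := by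
    rw [hsymm x u hu', (Θ x).right_inv hu']
  simpa using this

/-- The preimage of a slice by a submersion is a slice. -/
theorem IsSliceAt.preimage {m c : ℕ} {M : Type*} [TopologicalSpace M] [ChartedSpace (Model 𝕜 m) M]
    [IsManifold (mdl 𝕜 n) ∞ N] {f : N → M} {L : Set M} {x : N}
    (hf : Manifold.IsSubmersionAt (mdl 𝕜 n) (mdl 𝕜 m) ∞ f x)
    (h : IsSliceAt 𝕜 m k c L (f x)) : IsSliceAt 𝕜 n (k + (n - m)) c (f ⁻¹' L) x := by
  obtain ⟨-, hf⟩ := hf.model_complement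
  obtain ⟨φ, hφ, ψ, hψ, e, hx, hm, hw⟩ := hf.exists_charts
  obtain ⟨Θ, hΘ, hxΘ, e', he'⟩ := h
  -- Replacing `ψ` by the slice chart `Θ` on the base factor gives a chart `Φ` of `N` whose base
  -- coordinate is `Θ ∘ f`, so the equation of `L` pulls back unchanged.
  let T : OpenPartialHomeomorph (Model 𝕜 m × Model 𝕜 (n - m)) (Model 𝕜 m × Model 𝕜 (n - m)) :=
    (ψ.symm.trans Θ).prod (OpenPartialHomeomorph.refl _)
  let Φ : OpenPartialHomeomorph N (Model 𝕜 n) :=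
    ((φ.trans e.toHomeomorph.toOpenPartialHomeomorph).trans T).trans
      e.symm.toHomeomorph.toOpenPartialHomeomorph
  have hsrc : ∀ y, y ∈ Φ.source ↔ y ∈ φ.source ∧ f y ∈ Θ.source := by
    intro y
    simp only [Φ, T, mfld_simps]
    constructor
    · rintro ⟨h1, h2, h3⟩
      refine ⟨h1, ?_⟩
      have : (e (φ y)).1 = ψ (f y) := (hw y h1).symm
      simpa [this, ψ.left_inv (hm h1)] using h3
    · rintro ⟨h1, h2⟩
      have : (e (φ y)).1 = ψ (f y) := (hw y h1).symm
      refine ⟨h1, ?_, ?_⟩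
      · simpa [this] using ψ.map_source (hm h1)
      · simpa [this, ψ.left_inv (hm h1)] using h2
  have happ : ∀ y, Φ y = e.symm (Θ (ψ.symm (e (φ y)).1), (e (φ y)).2) := fun y => rfl
  have hap : ∀ y ∈ Φ.source, Φ y = e.symm (Θ (f y), (e (φ y)).2) := fun y hy => by
    rw [happ, ← hw y ((hsrc y).1 hy).1, ψ.left_inv (hm ((hsrc y).1 hy).1)]
  have hΦ : Φ ∈ IsManifold.maximalAtlas (mdl 𝕜 n) ∞ N := by
    refine Φ.mem_maximalAtlas_of_contMDiffOn (fun y hy => ?_) (fun v hv => ?_)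
    · obtain ⟨h1, h2⟩ := (hsrc y).1 hy
      have a1 := contMDiffAt_of_mem_maximalAtlas hφ h1
      have a2 : ContMDiffAt (mdl 𝕜 n) (mdl 𝕜 m) ∞ (fun y => (e (φ y)).1) y :=
        ContMDiffAt.comp (g := fun u => (e u).1) y
          (contDiff_fst.comp e.contDiff).contMDiff.contMDiffAt a1
      have a2' : ContMDiffAt (mdl 𝕜 n) (mdl 𝕜 (n - m)) ∞ (fun y => (e (φ y)).2) y :=
        ContMDiffAt.comp (g := fun u => (e u).2) y
          (contDiff_snd.comp e.contDiff).contMDiff.contMDiffAt a1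
      have a3 : ContMDiffAt (mdl 𝕜 m) (mdl 𝕜 m) ∞ ψ.symm (e (φ y)).1 :=
        contMDiffAt_symm_of_mem_maximalAtlas hψ (by rw [← hw y h1]; exact ψ.map_source (hm h1))
      have a4 : ContMDiffAt (mdl 𝕜 m) (mdl 𝕜 m) ∞ Θ (ψ.symm (e (φ y)).1) :=
        contMDiffAt_of_mem_maximalAtlas hΘ (by rwa [← hw y h1, ψ.left_inv (hm h1)])
      have a5 := ContMDiffAt.comp (g := Θ) y a4 (ContMDiffAt.comp (g := ψ.symm) y a3 a2)
      exact (ContMDiffAt.comp (g := e.symm) y e.symm.contDiff.contMDiff.contMDiffAt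
        (a5.prodMk_space a2')).contMDiffWithinAt
    · have hvy := Φ.map_target hv
      obtain ⟨h1, h2⟩ := (hsrc _).1 hvy
      have hv' : v = e.symm (Θ (f (Φ.symm v)), (e (φ (Φ.symm v))).2) := by
        rw [← hap _ hvy, Φ.right_inv hv]
      have hv1 : (e v).1 = Θ (f (Φ.symm v)) := by
        conv_lhs => rw [hv', e.apply_symm_apply]
      have hv2 : Θ.symm (e v).1 = f (Φ.symm v) := by rw [hv1, Θ.left_inv h2]
      have hs : Φ.symm v = φ.symm (e.symm (ψ (Θ.symm (e v).1), (e v).2)) := rfl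
      have hv3 : e.symm (ψ (Θ.symm (e v).1), (e v).2) = φ (Φ.symm v) := by
        rw [hv2, hw _ h1, ContinuousLinearEquiv.symm_apply_eq]
        refine Prod.ext rfl ?_
        conv_lhs => rw [hv', e.apply_symm_apply]
      have a1 : ContMDiffAt (mdl 𝕜 n) (mdl 𝕜 m) ∞ (fun v => (e v).1) v :=
        (contDiff_fst.comp e.contDiff).contMDiff.contMDiffAt
      have a1' : ContMDiffAt (mdl 𝕜 n) (mdl 𝕜 (n - m)) ∞ (fun v => (e v).2) v :=
        (contDiff_snd.comp e.contDiff).contMDiff.contMDiffAt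
      have a2 : ContMDiffAt (mdl 𝕜 m) (mdl 𝕜 m) ∞ Θ.symm (e v).1 :=
        contMDiffAt_symm_of_mem_maximalAtlas hΘ (by rw [hv1]; exact Θ.map_source h2)
      have a3 : ContMDiffAt (mdl 𝕜 m) (mdl 𝕜 m) ∞ ψ (Θ.symm (e v).1) :=
        contMDiffAt_of_mem_maximalAtlas hψ (by rw [hv2]; exact hm h1)
      have a4 : ContMDiffAt (mdl 𝕜 n) (mdl 𝕜 n) ∞ φ.symm
          (e.symm (ψ (Θ.symm (e v).1), (e v).2)) :=
        contMDiffAt_symm_of_mem_maximalAtlas hφ (by rw [hv3]; exact φ.map_source h1)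
      have a5 := ContMDiffAt.comp (g := ψ) v a3 (ContMDiffAt.comp (g := Θ.symm) v a2 a1)
      exact (ContMDiffAt.comp (g := φ.symm) v a4
        (ContMDiffAt.comp (g := e.symm) v e.symm.contDiff.contMDiff.contMDiffAt
          (a5.prodMk_space a1'))).contMDiffWithinAt
  obtain ⟨j⟩ : Nonempty ((Model 𝕜 k × Model 𝕜 (n - m)) ≃L[𝕜] Model 𝕜 (k + (n - m))) :=
    ContinuousLinearEquiv.nonempty_model (by simp)
  -- The fibre coordinates of `f` join the `k` coordinates along `L`; the `c` transverse ones stay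
  -- apart.
  let E : Model 𝕜 n ≃L[𝕜] Model 𝕜 (k + (n - m)) × Model 𝕜 c :=
    e.trans ((e'.prodCongr (.refl 𝕜 _)).trans ((ContinuousLinearEquiv.prodAssoc 𝕜 _ _ _).trans
      ((((ContinuousLinearEquiv.refl 𝕜 _).prodCongr (.prodComm 𝕜 _ _)).trans
        (ContinuousLinearEquiv.prodAssoc 𝕜 _ _ _).symm).trans (j.prodCongr (.refl 𝕜 _)))))
  have hE : ∀ v, (E v).2 = (e' (e v).1).2 := fun v => rfl
  refine ⟨Φ, hΦ, (hsrc x).2 ⟨hx, hxΘ⟩, E, fun y hy => ?_⟩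
  rw [hE, hap y hy, e.apply_symm_apply, ← he' _ ((hsrc y).1 hy).2]
  rfl

end Embedded

end

noncomputable section

variable {𝕜 : Type} [RCLike 𝕜]

/-! ### Inverse function theorem and local sections from surjective differentials. -/

section InverseFunction

variable {n : ℕ} {X : Type*} [TopologicalSpace X] [ChartedSpace (Model 𝕜 n) X]
  {V : Type*} [NormedAddCommGroup V] [NormedSpace 𝕜 V]

/-- The inverse function theorem for maps from a vector space to a manifold. -/
theorem ContMDiffNear.exists_openPartialHomeomorph [FiniteDimensional 𝕜 V] {f : V → X} {v : V}
    (hf : ContMDiffNear 𝓘(𝕜, V) (mdl 𝕜 n) f v) {χ : OpenPartialHomeomorph X (Model 𝕜 n)}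
    (hχ : χ ∈ IsManifold.maximalAtlas (mdl 𝕜 n) ∞ X) (hv : f v ∈ χ.source)
    {D : V ≃L[𝕜] Model 𝕜 n} (hD : HasFDerivAt (fun u => χ (f u)) (D : V →L[𝕜] Model 𝕜 n) v) :
    ∃ h : OpenPartialHomeomorph V X, v ∈ h.source ∧ (∀ u ∈ h.source, h u = f u) ∧
      ContMDiffOn 𝓘(𝕜, V) (mdl 𝕜 n) ∞ h h.source ∧
      ContMDiffOn (mdl 𝕜 n) 𝓘(𝕜, V) ∞ h.symm h.target := by
  have : CompleteSpace V := FiniteDimensional.complete 𝕜 V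
  have hg : ContMDiffNear 𝓘(𝕜, V) (mdl 𝕜 n) (fun u => χ (f u)) v :=
    ContMDiffNear.comp (g := χ) (.of_mem_maximalAtlas hχ hv) hf
  have hgv : ContDiffAt 𝕜 ∞ (fun u => χ (f u)) v := hg.contMDiffAt.contDiffAt
  let G := hgv.toOpenPartialHomeomorph (fun u => χ (f u)) hD (by simp)
  have hG : ∀ u, G u = χ (f u) := fun u => rfl
  have hvG : v ∈ G.source := hgv.mem_toOpenPartialHomeomorph_source hD (by simp)
  have hcf : ContinuousAt (fderiv 𝕜 (fun u => χ (f u))) v :=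
    (hgv.fderiv_right (m := 0) (by simp)).continuousAt
  -- Smoothness of the inverse on its whole domain needs an invertible derivative at every nearby
  -- point; invertible maps form an open set.
  have hequiv : ∀ᶠ u in 𝓝 v, ∃ D' : V ≃L[𝕜] Model 𝕜 n,
      (D' : V →L[𝕜] Model 𝕜 n) = fderiv 𝕜 (fun u => χ (f u)) u := by
    have h0 : range ((↑) : (V ≃L[𝕜] Model 𝕜 n) → V →L[𝕜] Model 𝕜 n) ∈
        𝓝 (fderiv 𝕜 (fun u => χ (f u)) v) := by
      rw [hD.fderiv]
      exact ContinuousLinearEquiv.nhds D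
    exact hcf.eventually h0
  obtain ⟨O, hO, hOo, hvO⟩ := eventually_nhds_iff.1 (hg.and (hf.and (hequiv.and
    (hf.continuousAt.eventually (χ.open_source.mem_nhds hv)))))
  let h := (G.restr O).trans χ.symm
  have hsrc : ∀ u, u ∈ h.source → u ∈ G.source ∧ u ∈ O := by
    intro u hu
    simp only [h, mfld_simps, hOo.interior_eq] at hu
    exact hu.1
  have happ : ∀ u ∈ h.source, h u = f u := by
    intro u hu
    change χ.symm (χ (f u)) = f u
    exact χ.left_inv (hO u (hsrc u hu).2).2.2.2
  refine ⟨h, ?_, happ, fun u hu => ?_, fun x hx => ?_⟩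
  · simp only [h, mfld_simps, hOo.interior_eq]
    exact ⟨⟨hvG, hvO⟩, χ.map_source hv⟩
  · exact ((hO u (hsrc u hu).2).2.1.contMDiffWithinAt).congr_of_mem
      (fun y hy => happ y hy) hu
  · have hu := h.map_target hx
    have hxs : h.symm x = G.symm (χ x) := rfl
    obtain ⟨hu1, hu2⟩ := hsrc _ hu
    have hx1 : x = f (h.symm x) := by rw [← happ _ hu, h.right_inv hx]
    have hxχ : x ∈ χ.source := by rw [hx1]; exact (hO _ hu2).2.2.2
    obtain ⟨D', hD'⟩ := (hO _ hu2).2.2.1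
    have hχG : χ x ∈ G.target := by
      rw [hx1, ← hG]; exact G.map_source hu1
    have hcd : ContDiffAt 𝕜 ∞ (fun u => χ (f u)) (h.symm x) := (hO _ hu2).1.contDiffAt
    have hsm : ContDiffAt 𝕜 ∞ G.symm (χ x) := by
      refine G.contDiffAt_symm (f₀' := D') hχG ?_ hcd
      rw [hD']
      exact (hcd.differentiableAt (by simp)).hasFDerivAt
    exact (ContMDiffAt.comp (g := G.symm) x hsm.contMDiffAt
      (contMDiffAt_of_mem_maximalAtlas hχ hxχ)).contMDiffWithinAt

/-- A smooth map with surjective differential at `v` has a local section through `v`. -/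
theorem ContMDiffNear.exists_section [IsManifold (mdl 𝕜 n) ∞ X] {f : V → X} {v : V}
    (hf : ContMDiffNear 𝓘(𝕜, V) (mdl 𝕜 n) f v)
    (hs : Function.Surjective (mfderiv 𝓘(𝕜, V) (mdl 𝕜 n) f v)) :
    ∃ τ : X → V, ContMDiffNear (mdl 𝕜 n) 𝓘(𝕜, V) τ (f v) ∧ τ (f v) = v ∧
      ∀ᶠ x in 𝓝 (f v), f (τ x) = x := by
  have hmd := hf.mdifferentiableAt
  have hχ := IsManifold.chart_mem_maximalAtlas (I := mdl 𝕜 n) (n := ∞) (f v)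
  have hd : DifferentiableAt 𝕜 (fun u => chartAt (Model 𝕜 n) (f v) (f u)) v := by
    have : ContMDiffNear 𝓘(𝕜, V) (mdl 𝕜 n) (fun u => chartAt (Model 𝕜 n) (f v) (f u)) v :=
      ContMDiffNear.comp (g := chartAt (Model 𝕜 n) (f v))
        (.of_mem_maximalAtlas hχ (mem_chart_source _ _)) hf
    exact this.contMDiffAt.contDiffAt.differentiableAt (by simp)
  have hm : mfderiv 𝓘(𝕜, V) (mdl 𝕜 n) f v =
      fderiv 𝕜 (fun u => chartAt (Model 𝕜 n) (f v) (f u)) v := by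
    rw [hmd.mfderiv]
    simp only [writtenInExtChartAt, mfld_simps, fderivWithin_univ]
    rfl
  set D := fderiv 𝕜 (fun u => chartAt (Model 𝕜 n) (f v) (f u)) v with hDdef
  have hs' : Function.Surjective (D : V →ₗ[𝕜] Model 𝕜 n) := by
    intro w
    obtain ⟨u, hu⟩ := hs w
    exact ⟨u, by rw [← hu, hm]; rfl⟩
  -- Along the affine subspace `v + A w`, with `A` a right inverse of the differential, `f` has
  -- derivative the identity in the chart, and the inverse function theorem applies.
  obtain ⟨A, hA⟩ := (D : V →ₗ[𝕜] Model 𝕜 n).exists_rightInverse_of_surjective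
    (LinearMap.range_eq_top.2 hs')
  let A' : Model 𝕜 n →L[𝕜] V := LinearMap.toContinuousLinearMap A
  have hA' : D.comp A' = ContinuousLinearMap.id 𝕜 _ := by
    ext1 w; exact congrArg (fun l => l w) hA
  have hin : ContMDiffNear 𝓘(𝕜, Model 𝕜 n) 𝓘(𝕜, V) (fun w => v + A' w) 0 :=
    ContDiff.contMDiffNear (by fun_prop) 0
  have hf' : ContMDiffNear (mdl 𝕜 n) (mdl 𝕜 n) (fun w => f (v + A' w)) 0 :=
    ContMDiffNear.comp_of_eq hf hin (by simp)
  have hder : HasFDerivAt (fun w => chartAt (Model 𝕜 n) (f v) (f (v + A' w)))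
      ((ContinuousLinearEquiv.refl 𝕜 (Model 𝕜 n) : Model 𝕜 n ≃L[𝕜] Model 𝕜 n) :
        Model 𝕜 n →L[𝕜] Model 𝕜 n) 0 := by
    have h1 : HasFDerivAt (fun w => v + A' w) A' (0 : Model 𝕜 n) :=
      A'.hasFDerivAt.const_add v
    have h2 : HasFDerivAt (fun u => chartAt (Model 𝕜 n) (f v) (f u)) D (v + A' 0) := by
      simpa using hd.hasFDerivAt
    have := h2.comp (0 : Model 𝕜 n) h1
    rw [hA'] at this
    exact this
  obtain ⟨h, h0, h1, h2, h3⟩ := hf'.exists_openPartialHomeomorph hχ (by simp) hder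
  have hfv : h 0 = f v := by rw [h1 0 h0]; simp
  have hfv' : f v ∈ h.target := hfv ▸ h.map_source h0
  refine ⟨fun x => v + A' (h.symm x), ?_, ?_, ?_⟩
  · refine ContMDiffNear.comp_of_eq (g := fun w => v + A' w) (y := 0) hin ?_ ?_
    · filter_upwards [h.open_target.mem_nhds hfv'] with x hx
      exact h3.contMDiffAt (h.open_target.mem_nhds hx)
    · rw [← hfv, h.left_inv h0]
  · simp only
    rw [← hfv, h.left_inv h0]; simp
  · filter_upwards [h.open_target.mem_nhds hfv'] with x hx
    rw [← h1 _ (h.map_target hx), h.right_inv hx]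

end InverseFunction

/-! ### Quotients of manifolds by locally foliated relations. -/

section Quotient

variable {n d k : ℕ} {P Z : Type*} [TopologicalSpace P] [ChartedSpace (Model 𝕜 n) P]
  [TopologicalSpace Z]

variable (𝕜 n) in
/-- Near `x`, the fibres of `p` are the plaques `{u} × Model 𝕜 k` of some chart. -/
def IsFoliatedAt (d k : ℕ) (p : P → Z) (x : P) : Prop :=
  ∃ h : OpenPartialHomeomorph (Model 𝕜 d × Model 𝕜 k) P,
    ContMDiffOn 𝓘(𝕜, Model 𝕜 d × Model 𝕜 k) (mdl 𝕜 n) ∞ h h.source ∧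
    ContMDiffOn (mdl 𝕜 n) 𝓘(𝕜, Model 𝕜 d × Model 𝕜 k) ∞ h.symm h.target ∧
    x ∈ h.target ∧ ∃ c : Model 𝕜 k, (∀ v ∈ h.source, (v.1, c) ∈ h.source) ∧
      ∀ v ∈ h.source, ∀ v' ∈ h.source, p (h v) = p (h v') ↔ v.1 = v'.1

/-- Godement's criterion, for quotients with locally foliated charts which can be transported along
the fibres. -/
theorem exists_quotient_manifold [IsManifold (mdl 𝕜 n) ∞ P] {p : P → Z} (hn : d + k = n)
    (hp : IsOpenQuotientMap p) (hfol : ∀ x, IsFoliatedAt 𝕜 n d k p x)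
    (htr : ∀ x y, p x = p y → ∃ T : P → P, ContMDiffNear (mdl 𝕜 n) (mdl 𝕜 n) T x ∧ T x = y ∧
      ∀ᶠ z in 𝓝 x, p (T z) = p z) :
    ∃ _ : ChartedSpace (Model 𝕜 d) Z, IsManifold (mdl 𝕜 d) ∞ Z ∧
      Manifold.IsSubmersion (mdl 𝕜 n) (mdl 𝕜 d) ∞ p := by
  classical
  choose h hh hhs hx c hc hfib using hfol
  -- The plaque coordinate of any representative in the chart domain; `hfib` makes it independent of
  -- the choice.
  let ψ : P → Z → Model 𝕜 d := fun x z =>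
    if hz : ∃ y ∈ (h x).target, p y = z then ((h x).symm hz.choose).1 else 0
  have hψ : ∀ x, ∀ y ∈ (h x).target, ψ x (p y) = ((h x).symm y).1 := by
    intro x y hy
    have hz : ∃ y' ∈ (h x).target, p y' = p y := ⟨y, hy, rfl⟩
    have h1 := hz.choose_spec
    simp only [ψ, dif_pos hz]
    rw [← hfib x _ ((h x).map_target h1.1) _ ((h x).map_target hy), (h x).right_inv h1.1,
      (h x).right_inv hy, h1.2]
  have hψ' : ∀ x, ∀ v ∈ (h x).source, ψ x (p (h x v)) = v.1 := by
    intro x v hv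
    rw [hψ x _ ((h x).map_source hv), (h x).left_inv hv]
  let ch : P → OpenPartialHomeomorph Z (Model 𝕜 d) := fun x =>
    { toFun := ψ x
      -- The section at constant height `c x` meets every plaque; the height in `IsFoliatedAt` is
      -- there for this inverse.
      invFun := fun u => p (h x (u, c x))
      source := p '' (h x).target
      target := Prod.fst '' (h x).source
      map_source' := by
        rintro _ ⟨y, hy, rfl⟩
        rw [hψ x y hy]
        exact mem_image_of_mem _ ((h x).map_target hy)
      map_target' := by
        rintro _ ⟨v, hv, rfl⟩
        exact mem_image_of_mem _ ((h x).map_source (hc x v hv))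
      left_inv' := by
        rintro _ ⟨y, hy, rfl⟩
        have hv := (h x).map_target hy
        rw [hψ x y hy]
        conv_rhs => rw [← (h x).right_inv hy]
        exact (hfib x _ (hc x _ hv) _ hv).2 rfl
      right_inv' := by
        rintro _ ⟨v, hv, rfl⟩
        exact hψ' x _ (hc x v hv)
      open_source := hp.isOpenMap _ (h x).open_target
      open_target := isOpenMap_fst _ (h x).open_source
      continuousOn_toFun := by
        rintro _ ⟨y, hy, rfl⟩
        refine ContinuousAt.continuousWithinAt ?_
        rw [← hp.continuousAt_comp_iff]
        have h1 : ContinuousAt (fun y => ((h x).symm y).1) y :=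
          continuousAt_fst.comp ((h x).continuousAt_symm hy)
        refine h1.congr ?_
        filter_upwards [(h x).open_target.mem_nhds hy] with y' hy'
        exact (hψ x y' hy').symm
      continuousOn_invFun := by
        refine hp.continuous.comp_continuousOn ((h x).continuousOn.comp (by fun_prop) ?_)
        rintro _ ⟨v, hv, rfl⟩
        exact hc x v hv }
  obtain ⟨cs, hman, hmax⟩ := exists_chartedSpace_of_cover ch
    (fun z => by
      obtain ⟨x, rfl⟩ := hp.surjective z
      exact ⟨x, x, hx x, rfl⟩) (by
    rintro i j z ⟨y, hy, rfl⟩ ⟨y', hy', hyy⟩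
    have hv := (h i).map_target hy
    have hu : ch i (p y) = ((h i).symm y).1 := hψ i y hy
    have hcv := hc i _ hv
    set u := ((h i).symm y).1
    have hpx : p (h i (u, c i)) = p y' := by
      rw [hyy]
      conv_rhs => rw [← (h i).right_inv hy]
      exact (hfib i _ hcv _ hv).2 rfl
    -- The two charts may see the same fibre at distant points. The transport `T` carries one to the
    -- other, so the transition map is locally a composite of smooth maps through `T`.
    obtain ⟨T, hT, hTx, hpT⟩ := htr _ _ hpx
    have a1 : ContMDiffNear 𝓘(𝕜, Model 𝕜 d) 𝓘(𝕜, Model 𝕜 d × Model 𝕜 k)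
        (fun w => (w, c i)) u := ContDiff.contMDiffNear (by fun_prop) _
    have a2 : ContMDiffNear 𝓘(𝕜, Model 𝕜 d × Model 𝕜 k) (mdl 𝕜 n) (h i) (u, c i) := by
      filter_upwards [(h i).open_source.mem_nhds hcv] with w hw
      exact (hh i).contMDiffAt ((h i).open_source.mem_nhds hw)
    have a3 : ContMDiffNear (mdl 𝕜 n) 𝓘(𝕜, Model 𝕜 d × Model 𝕜 k) (h j).symm y' := by
      filter_upwards [(h j).open_target.mem_nhds hy'] with w hw
      exact (hhs j).contMDiffAt ((h j).open_target.mem_nhds hw)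
    have b1 := a2.comp_of_eq a1 rfl
    have b2 := hT.comp_of_eq b1 rfl
    have b3 := a3.comp_of_eq b2 hTx
    have b4 : ContMDiffNear 𝓘(𝕜, Model 𝕜 d) 𝓘(𝕜, Model 𝕜 d)
        (fun w => ((h j).symm (T (h i (w, c i)))).1) u :=
      ContMDiffNear.comp (g := Prod.fst) (ContDiff.contMDiffNear contDiff_fst _) b3
    rw [hu]
    refine b4.contMDiffAt.contDiffAt.congr_of_eventuallyEq ?_
    have hTt : (h j).target ∈ 𝓝 (T (h i (u, c i))) := by
      rw [hTx]; exact (h j).open_target.mem_nhds hy'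
    filter_upwards [b1.continuousAt.eventually hpT, b2.continuousAt.eventually hTt] with w hw hw'
    change ψ j (p (h i (w, c i))) = _
    rw [← hw, hψ j _ hw'])
  refine ⟨cs, hman, ?_⟩
  obtain ⟨e⟩ : Nonempty ((Model 𝕜 d × Model 𝕜 k) ≃L[𝕜] Model 𝕜 n) :=
    ContinuousLinearEquiv.nonempty_model (by simp [hn])
  refine Manifold.IsSubmersionOfComplement.isSubmersion (F := Model 𝕜 k) fun x => ?_
  let E := (h x).symm.trans e.toHomeomorph.toOpenPartialHomeomorph
  have hE : E ∈ IsManifold.maximalAtlas (mdl 𝕜 n) ∞ P := by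
    refine E.mem_maximalAtlas_of_contMDiffOn (fun y hy => ?_) fun v hv => ?_
    · have hy : y ∈ (h x).target := by simpa [E] using hy
      exact (ContMDiffAt.comp (g := e) y e.contDiff.contMDiff.contMDiffAt
        ((hhs x).contMDiffAt ((h x).open_target.mem_nhds hy))).contMDiffWithinAt
    · have hv : e.symm v ∈ (h x).source := by simpa [E] using hv
      exact (ContMDiffAt.comp (g := h x) v
        ((hh x).contMDiffAt ((h x).open_source.mem_nhds hv))
        e.symm.contDiff.contMDiff.contMDiffAt).contMDiffWithinAt
  refine Manifold.IsSubmersionAtOfComplement.mk_of_charts e.symm E (ch x) ?_ ?_ hE (hmax x) ?_ ?_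
  · simpa [E] using hx x
  · exact mem_image_of_mem p (hx x)
  · intro y hy
    exact mem_image_of_mem p (by simpa [E] using hy)
  · intro v hv
    have hv : e.symm v ∈ (h x).source := by simpa [E] using hv
    exact hψ' x _ hv

end Quotient

end

noncomputable section

variable {𝕜 : Type} [RCLike 𝕜]

/-- An injective linear map `B` can be completed to a linear isomorphism. -/
theorem exists_complementary_map {k n : ℕ} (B : Model 𝕜 k →L[𝕜] Model 𝕜 n)
    (hB : Function.Injective B) :
    (n - k) + k = n ∧ ∃ (ι : Model 𝕜 (n - k) →L[𝕜] Model 𝕜 n)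
      (D : (Model 𝕜 (n - k) × Model 𝕜 k) ≃L[𝕜] Model 𝕜 n), ∀ w c, D (w, c) = ι w + B c := by
  let B' : Model 𝕜 k →ₗ[𝕜] Model 𝕜 n := B.toLinearMap
  obtain ⟨W, hW⟩ := (LinearMap.range B').exists_isCompl
  have h1 : Module.finrank 𝕜 (LinearMap.range B') = k := by
    rw [LinearMap.finrank_range_of_inj hB]; simp
  have h2 := Submodule.finrank_add_eq_of_isCompl hW
  rw [h1, finrank_euclideanSpace, Fintype.card_fin] at h2
  obtain ⟨j⟩ : Nonempty (W ≃L[𝕜] Model 𝕜 (n - k)) :=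
    ContinuousLinearEquiv.nonempty_model (by omega)
  let ι : Model 𝕜 (n - k) →ₗ[𝕜] Model 𝕜 n := W.subtype ∘ₗ j.symm.toLinearMap
  let D₀ : (Model 𝕜 (n - k) × Model 𝕜 k) →ₗ[𝕜] Model 𝕜 n := ι.coprod B'
  have hinj : Function.Injective D₀ := by
    rw [← LinearMap.ker_eq_bot, LinearMap.ker_eq_bot']
    rintro ⟨w, c⟩ h0
    have h0 : ((j.symm w : W) : Model 𝕜 n) + B c = 0 := h0
    have hm : ((j.symm w : W) : Model 𝕜 n) = B (-c) := by
      rw [map_neg]; exact eq_neg_of_add_eq_zero_left h0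
    have hz : ((j.symm w : W) : Model 𝕜 n) = 0 :=
      Submodule.disjoint_def.1 hW.disjoint _ ⟨-c, hm.symm⟩ (Subtype.coe_prop _)
    have hw : w = 0 := by
      have : j.symm w = 0 := Subtype.ext hz
      simpa using this
    rw [hz, zero_add] at h0
    have hc : c = 0 := hB (by rw [h0, map_zero])
    rw [hw, hc]; rfl
  have hfin : Module.finrank 𝕜 (Model 𝕜 (n - k) × Model 𝕜 k) = Module.finrank 𝕜 (Model 𝕜 n) := by
    simp; omega
  exact ⟨by omega, LinearMap.toContinuousLinearMap ι,
    (LinearEquiv.ofInjectiveOfFinrankEq D₀ hinj hfin).toContinuousLinearEquiv, fun w c => rfl⟩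

/-! ### Groupoid multiplication and the left action of `R` on `Γ_L`. -/

section Groupoid

variable {g m : ℕ} {Γ M : Type*}
  [TopologicalSpace Γ] [ChartedSpace (Model 𝕜 g) Γ]
  [TopologicalSpace M] [ChartedSpace (Model 𝕜 m) M]

section Mul

variable (G : LieGroupoid 𝕜 g m Γ M)
  {E H X : Type*} [NormedAddCommGroup E] [NormedSpace 𝕜 E] [TopologicalSpace H]
  {I : ModelWithCorners 𝕜 E H} [TopologicalSpace X] [ChartedSpace H X]

theorem LieGroupoid.contMDiffWithinAt_mul {f f' : X → Γ} {s : Set X} {x : X} (hxs : x ∈ s)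
    (hf : ContMDiffWithinAt I (mdl 𝕜 g) ∞ f s x) (hf' : ContMDiffWithinAt I (mdl 𝕜 g) ∞ f' s x)
    (h : ∀ᶠ y in 𝓝[s] x, G.tgt (f y) = G.src (f' y)) :
    ContMDiffWithinAt I (mdl 𝕜 g) ∞ (fun y => G.mul (f y) (f' y)) s x := by
  have h1 := G.smooth_mul (f x, f' x) (h.self_of_nhdsWithin hxs)
  have h2 : ContMDiffWithinAt I (mdl 𝕜 g) ∞ (fun y => G.mul (f y) (f' y))
      (s ∩ {y | G.tgt (f y) = G.src (f' y)}) x :=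
    ContMDiffWithinAt.comp (g := fun p : Γ × Γ => G.mul p.1 p.2) x h1
      ((hf.prodMk hf').mono inter_subset_left) fun y hy => hy.2
  exact h2.mono_of_mem_nhdsWithin (Filter.inter_mem self_mem_nhdsWithin h)

theorem LieGroupoid.contMDiffNear_mul {f f' : X → Γ} {x : X}
    (hf : ContMDiffNear I (mdl 𝕜 g) f x) (hf' : ContMDiffNear I (mdl 𝕜 g) f' x)
    (h : ∀ᶠ y in 𝓝 x, G.tgt (f y) = G.src (f' y)) :
    ContMDiffNear I (mdl 𝕜 g) (fun y => G.mul (f y) (f' y)) x := by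
  filter_upwards [hf, hf', h.eventually_nhds] with y h1 h2 h3
  exact G.contMDiffWithinAt_mul (mem_univ y) h1 h2 (by rwa [nhdsWithin_univ])

/-- Freeness of left multiplication: division recovers `r` from `rγ` and `γ`. Closeness to units and
closedness of the orbit relation are both read off this division. -/
theorem LieGroupoid.mul_inv_cancel_right (r γ : Γ) (h : G.tgt r = G.src γ) :
    G.mul (G.mul r γ) (G.inv γ) = r := by
  rw [G.mul_assoc _ _ _ h (G.src_inv γ).symm, G.mul_inv, ← h, G.mul_one]

end Mul

namespace LieSubgroupoid

variable {G : LieGroupoid 𝕜 g m Γ M} (R : LieSubgroupoid G)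

/-- The source map of `Γ_L`, with values in `L`. -/
def srcL (γ : R.bundle) : R.objects.carrier := ⟨G.src γ, γ.2⟩

/-- The target map of `R`. -/
def tgtR (r : R.arrows.carrier) : R.objects.carrier := ⟨G.tgt r, R.tgt_mem r r.2⟩

/-- The units of `R`. -/
def oneR (x : R.objects.carrier) : R.arrows.carrier := ⟨G.one x, R.one_mem x x.2⟩

open Classical in
/-- The left action of `R` on `Γ_L`. -/
def actL (r : R.arrows.carrier) (γ : R.bundle) : R.bundle :=
  if h : R.tgtR r = R.srcL γ then
    ⟨G.mul r γ, by
      have h : G.tgt r = G.src γ := congrArg Subtype.val h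
      change G.src (G.mul r γ) ∈ R.objects.carrier
      rw [G.src_mul _ _ h]
      exact R.src_mem r r.2⟩
  -- With this default, `proj_actL` and `tgt_actL` hold without a composability hypothesis.
  else γ

variable {R} in
theorem coe_actL {r : R.arrows.carrier} {γ : R.bundle} (h : R.tgtR r = R.srcL γ) :
    (R.actL r γ : Γ) = G.mul r γ := by
  rw [actL, dif_pos h]

theorem proj_eq_iff {γ γ' : R.bundle} :
    R.proj γ = R.proj γ' ↔ ∃ r : R.arrows.carrier, R.tgtR r = R.srcL γ' ∧ γ = R.actL r γ' := by
  constructor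
  · intro h
    obtain ⟨r, hr, h1, h2⟩ := Quotient.exact h
    have h1' : R.tgtR ⟨r, hr⟩ = R.srcL γ' := Subtype.ext h1
    exact ⟨⟨r, hr⟩, h1', Subtype.ext (by rw [coe_actL h1', h2])⟩
  · rintro ⟨r, h1, h2⟩
    exact Quotient.sound ⟨r, r.2, congrArg Subtype.val h1, by rw [h2, coe_actL h1]⟩

theorem proj_actL (r : R.arrows.carrier) (γ : R.bundle) : R.proj (R.actL r γ) = R.proj γ := by
  by_cases h : R.tgtR r = R.srcL γ
  · exact (R.proj_eq_iff).2 ⟨r, h, rfl⟩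
  · rw [actL, dif_neg h]

theorem tgt_actL (r : R.arrows.carrier) (γ : R.bundle) : G.tgt (R.actL r γ) = G.tgt γ := by
  by_cases h : R.tgtR r = R.srcL γ
  · rw [coe_actL h, G.tgt_mul _ _ (congrArg Subtype.val h)]
  · rw [actL, dif_neg h]

theorem actL_oneR (γ : R.bundle) : R.actL (R.oneR (R.srcL γ)) γ = γ := by
  have h : R.tgtR (R.oneR (R.srcL γ)) = R.srcL γ := Subtype.ext (G.tgt_one _)
  exact Subtype.ext (by rw [coe_actL h]; exact G.one_mul _)

theorem tgtR_oneR (x : R.objects.carrier) : R.tgtR (R.oneR x) = x := Subtype.ext (G.tgt_one _)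

theorem contMDiffNear_oneR (x : R.objects.carrier) :
    ContMDiffNear (mdl 𝕜 R.objects.dim) (mdl 𝕜 R.arrows.dim) R.oneR x :=
  R.arrows.isSmoothEmbedding.contMDiffNear_of_val
    ((G.smooth_one.comp R.objects.isSmoothEmbedding.contMDiff).contMDiffNear x)

theorem contMDiffNear_tgtR (r : R.arrows.carrier) :
    ContMDiffNear (mdl 𝕜 R.arrows.dim) (mdl 𝕜 R.objects.dim) R.tgtR r :=
  R.tgt_submersion.contMDiff.contMDiffNear r

/-- A parametrization of `R` near a unit by its target and a transverse coordinate which vanishes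
on units. -/
theorem exists_unit_param (x : R.objects.carrier) :
    ∃ (ρ : R.objects.carrier × Model 𝕜 (R.arrows.dim - R.objects.dim) → R.arrows.carrier)
      (κ : R.arrows.carrier → Model 𝕜 (R.arrows.dim - R.objects.dim)),
      ContMDiffNear ((mdl 𝕜 R.objects.dim).prod (mdl 𝕜 (R.arrows.dim - R.objects.dim)))
        (mdl 𝕜 R.arrows.dim) ρ (x, 0) ∧
      ContMDiffNear (mdl 𝕜 R.arrows.dim) (mdl 𝕜 (R.arrows.dim - R.objects.dim)) κ (R.oneR x) ∧
      κ (R.oneR x) = 0 ∧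
      (∀ᶠ r in 𝓝 (R.oneR x), ρ (R.tgtR r, κ r) = r) ∧
      (∀ᶠ p in 𝓝 (x, (0 : Model 𝕜 (R.arrows.dim - R.objects.dim))),
        R.tgtR (ρ p) = p.1 ∧ κ (ρ p) = p.2) ∧
      ∀ᶠ y in 𝓝 x, ρ (y, 0) = R.oneR y := by
  set k := R.arrows.dim - R.objects.dim
  obtain ⟨-, hF⟩ := (R.tgt_submersion.isSubmersionAt (R.oneR x)).model_complement
  obtain ⟨ρ, κ, h1, h2, h3, h4⟩ := hF.exists_param
  change ContMDiffNear _ _ ρ (R.tgtR (R.oneR x), _) at h1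
  change ∀ᶠ y in _, ρ (R.tgtR y, κ y) = y at h3
  change ∀ᶠ p in 𝓝 (R.tgtR (R.oneR x), _), R.tgtR (ρ p) = p.1 ∧ _ at h4
  rw [R.tgtR_oneR] at h1 h4
  have ho := R.contMDiffNear_oneR x
  have hκo : ContMDiffNear (mdl 𝕜 R.objects.dim) (mdl 𝕜 k) (fun y => κ (R.oneR y)) x :=
    h2.comp ho
  have hadd : ContMDiffNear ((mdl 𝕜 R.objects.dim).prod (mdl 𝕜 k)) (mdl 𝕜 k)
      (fun p : R.objects.carrier × Model 𝕜 k => p.2 + κ (R.oneR p.1)) (x, 0) := by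
    have a1 : ContMDiffNear ((mdl 𝕜 R.objects.dim).prod (mdl 𝕜 k)) (mdl 𝕜 k)
        (fun p : R.objects.carrier × Model 𝕜 k => κ (R.oneR p.1)) (x, 0) :=
      ContMDiffNear.comp_of_eq (g := fun y => κ (R.oneR y)) (f := Prod.fst) hκo
        (contMDiff_fst.contMDiffNear _) rfl
    filter_upwards [a1] with p hp
    exact contMDiffAt_snd.add hp
  have hin : ContMDiffNear ((mdl 𝕜 R.objects.dim).prod (mdl 𝕜 k))
      ((mdl 𝕜 R.objects.dim).prod (mdl 𝕜 k))
      (fun p : R.objects.carrier × Model 𝕜 k => (p.1, p.2 + κ (R.oneR p.1))) (x, 0) :=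
    (contMDiff_fst.contMDiffNear _).prodMk hadd
  have hsub : ContMDiffNear (mdl 𝕜 R.arrows.dim) (mdl 𝕜 k)
      (fun r => κ r - κ (R.oneR (R.tgtR r))) (R.oneR x) := by
    have a1 : ContMDiffNear (mdl 𝕜 R.arrows.dim) (mdl 𝕜 k)
        (fun r => κ (R.oneR (R.tgtR r))) (R.oneR x) :=
      hκo.comp_of_eq (R.contMDiffNear_tgtR _) (R.tgtR_oneR x)
    filter_upwards [h2, a1] with r hr hr'
    exact hr.sub hr'
  -- Translate the fibre coordinate by its value at the unit over the same target, so that units sit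
  -- at `0`.
  refine ⟨fun p => ρ (p.1, p.2 + κ (R.oneR p.1)), fun r => κ r - κ (R.oneR (R.tgtR r)),
    h1.comp_of_eq hin (by simp), hsub, by simp [R.tgtR_oneR], ?_, ?_, ?_⟩
  · filter_upwards [h3] with r hr
    simpa using hr
  · have hc : ContinuousAt (fun p : R.objects.carrier × Model 𝕜 k =>
        (p.1, p.2 + κ (R.oneR p.1))) (x, 0) := hin.continuousAt
    have h4' : ∀ᶠ p in 𝓝 ((fun p : R.objects.carrier × Model 𝕜 k =>
        (p.1, p.2 + κ (R.oneR p.1))) (x, 0)), R.tgtR (ρ p) = p.1 ∧ κ (ρ p) = p.2 := by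
      simpa using h4
    filter_upwards [hc.eventually h4'] with p hp
    refine ⟨hp.1, ?_⟩
    rw [hp.1, hp.2]; simp
  · filter_upwards [ho.continuousAt.eventually h3] with y hy
    simpa [R.tgtR_oneR] using hy

variable {n : ℕ} [ChartedSpace (Model 𝕜 n) R.bundle]

variable {R}

theorem contMDiff_srcL
    (hP : Manifold.IsSmoothEmbedding (mdl 𝕜 n) (mdl 𝕜 g) ∞ (Subtype.val : R.bundle → Γ)) :
    ContMDiff (mdl 𝕜 n) (mdl 𝕜 R.objects.dim) ∞ R.srcL := fun γ =>
  R.objects.isSmoothEmbedding.contMDiffWithinAt_of_val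
    ((G.src_submersion.contMDiff.comp hP.contMDiff) γ)

theorem contMDiffNear_actL
    (hP : Manifold.IsSmoothEmbedding (mdl 𝕜 n) (mdl 𝕜 g) ∞ (Subtype.val : R.bundle → Γ))
    {E H X : Type*} [NormedAddCommGroup E] [NormedSpace 𝕜 E]
    [TopologicalSpace H] {I : ModelWithCorners 𝕜 E H} [TopologicalSpace X] [ChartedSpace H X]
    {f : X → R.arrows.carrier} {q : X → R.bundle} {x : X}
    (hf : ContMDiffNear I (mdl 𝕜 R.arrows.dim) f x) (hq : ContMDiffNear I (mdl 𝕜 n) q x)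
    (h : ∀ᶠ y in 𝓝 x, R.tgtR (f y) = R.srcL (q y)) :
    ContMDiffNear I (mdl 𝕜 n) (fun y => R.actL (f y) (q y)) x := by
  refine hP.contMDiffNear_of_val ?_
  have h1 : ContMDiffNear I (mdl 𝕜 g) (fun y => G.mul (f y) (q y)) x :=
    G.contMDiffNear_mul
      ((R.arrows.isSmoothEmbedding.contMDiff.contMDiffNear _).comp hf)
      ((hP.contMDiff.contMDiffNear _).comp hq) (h.mono fun y hy => congrArg Subtype.val hy)
  exact h1.congr (h.mono fun y hy => (coe_actL hy).symm)

/-- Points of an `R`-orbit in `Γ_L` are related by a local map which preserves the orbits. -/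
theorem exists_transport
    (hP : Manifold.IsSmoothEmbedding (mdl 𝕜 n) (mdl 𝕜 g) ∞ (Subtype.val : R.bundle → Γ))
    (y y' : R.bundle) (h : R.proj y = R.proj y') :
    ∃ T : R.bundle → R.bundle, ContMDiffNear (mdl 𝕜 n) (mdl 𝕜 n) T y ∧ T y = y' ∧
      ∀ᶠ z in 𝓝 y, R.proj (T z) = R.proj z := by
  obtain ⟨r, h1, h2⟩ := R.proj_eq_iff.1 h.symm
  obtain ⟨τ, t1, t2, t3⟩ := (R.tgt_submersion.isSubmersionAt r).exists_section
  change ContMDiffNear _ _ τ (R.tgtR r) at t1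
  change τ (R.tgtR r) = r at t2
  change ∀ᶠ y in 𝓝 (R.tgtR r), R.tgtR (τ y) = y at t3
  rw [h1] at t1 t2 t3
  have hs := (contMDiff_srcL hP).contMDiffNear y
  -- Left multiplication by a section `τ` of the target of `R` passing through the arrow `r` that
  -- takes `y` to `y'`.
  refine ⟨fun z => R.actL (τ (R.srcL z)) z,
    contMDiffNear_actL hP (t1.comp hs) .id (hs.continuousAt.eventually t3), ?_, ?_⟩
  · simp only [t2, ← h2]
  · exact Filter.Eventually.of_forall fun z => R.proj_actL _ _

/-- The saturation of an open set is open: near each of its points, a transport moves points into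
the set along their orbits. -/
theorem isOpenQuotientMap_proj
    (hP : Manifold.IsSmoothEmbedding (mdl 𝕜 n) (mdl 𝕜 g) ∞ (Subtype.val : R.bundle → Γ)) :
    IsOpenQuotientMap R.proj := by
  refine ⟨Quotient.mk_surjective, continuous_quotient_mk', fun U hU => ?_⟩
  change IsOpen (R.proj ⁻¹' (R.proj '' U))
  rw [isOpen_iff_mem_nhds]
  rintro y ⟨u, hu, huy⟩
  obtain ⟨T, t1, t2, t3⟩ := exists_transport hP y u huy.symm
  have hU' : U ∈ 𝓝 (T y) := by rw [t2]; exact hU.mem_nhds hu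
  filter_upwards [t1.continuousAt.eventually hU', t3] with z hz hz'
  exact ⟨T z, hz, hz'⟩

end LieSubgroupoid

end Groupoid

end

noncomputable section

variable {𝕜 : Type} [RCLike 𝕜]
-- Slices for the action and the manifold structure of `Z(R)`.
section Slice

variable {g m : ℕ} {Γ M : Type*}
  [TopologicalSpace Γ] [ChartedSpace (Model 𝕜 g) Γ]
  [TopologicalSpace M] [ChartedSpace (Model 𝕜 m) M]

namespace LieSubgroupoid

variable {G : LieGroupoid 𝕜 g m Γ M} (R : LieSubgroupoid G)

/-- `Γ_L` is an embedded submanifold of `Γ`. -/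
theorem exists_isSmoothEmbedding_bundle [IsManifold (mdl 𝕜 g) ∞ Γ] :
    ∃ (n : ℕ) (_ : ChartedSpace (Model 𝕜 n) R.bundle), IsManifold (mdl 𝕜 n) ∞ R.bundle ∧
      Manifold.IsSmoothEmbedding (mdl 𝕜 n) (mdl 𝕜 g) ∞ (Subtype.val : R.bundle → Γ) :=
  ⟨_, exists_isSmoothEmbedding_of_isSliceAt fun γ hγ =>
    (R.objects.isSmoothEmbedding.isSliceAt (x := G.src γ) hγ).preimage
      (G.src_submersion.isSubmersionAt γ)⟩

variable {R} {n : ℕ} [ChartedSpace (Model 𝕜 n) R.bundle]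

/-- The orbit map `c ↦ ρ (c) · γ` has injective differential: it has a smooth local left inverse. -/
theorem exists_leftInverse_actL
    (hP : Manifold.IsSmoothEmbedding (mdl 𝕜 n) (mdl 𝕜 g) ∞ (Subtype.val : R.bundle → Γ))
    (γ : R.bundle) {k : ℕ} {κ : R.arrows.carrier → Model 𝕜 k}
    (hκ : ContMDiffNear (mdl 𝕜 R.arrows.dim) (mdl 𝕜 k) κ (R.oneR (R.srcL γ))) :
    ∃ l : R.bundle → Model 𝕜 k, ContMDiffNear (mdl 𝕜 n) (mdl 𝕜 k) l γ ∧
      ∀ᶠ r in 𝓝 (R.oneR (R.srcL γ)), R.tgtR r = R.srcL γ → l (R.actL r γ) = κ r := by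
  -- The left inverse is `x ↦ κ (q (x · β (tgt x)))`: as `tgt (rγ) = tgt γ` and `β (tgt γ) = γ⁻¹`,
  -- it divides `rγ` by `γ`.
  obtain ⟨β, b1, b2, b3⟩ := (G.src_submersion.isSubmersionAt (G.inv γ)).exists_section
  rw [G.src_inv] at b1 b2 b3
  obtain ⟨q, q1, q2⟩ := R.arrows.isSmoothEmbedding.exists_retraction (R.oneR (R.srcL γ))
  have hv := hP.contMDiff.contMDiffNear γ
  have ht : ContMDiffNear (mdl 𝕜 n) (mdl 𝕜 m) (fun x : R.bundle => G.tgt x) γ :=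
    (G.tgt_submersion.contMDiff.contMDiffNear _).comp hv
  have hβ : ContMDiffNear (mdl 𝕜 n) (mdl 𝕜 g) (fun x : R.bundle => β (G.tgt x)) γ :=
    b1.comp_of_eq ht rfl
  have hmul := G.contMDiffNear_mul hv hβ
    ((ht.continuousAt.eventually b3).mono fun x hx => hx.symm)
  have h1 : G.mul γ (β (G.tgt γ)) = R.oneR (R.srcL γ) := by rw [b2, G.mul_inv]; rfl
  have hl := hκ.comp_of_eq (q1.comp_of_eq hmul h1) (by rw [h1, q2.self_of_nhds])
  refine ⟨_, hl, ?_⟩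
  filter_upwards [q2] with r hr hrγ
  rw [R.tgt_actL, b2, coe_actL hrγ, G.mul_inv_cancel_right _ _ (congrArg Subtype.val hrγ), hr]

/-- Points close to `γ` in the same `R`-orbit differ by an element of `R` close to the unit. -/
theorem eventually_exists_actL
    (γ : R.bundle) {N : Set R.arrows.carrier} (hN : N ∈ 𝓝 (R.oneR (R.srcL γ))) :
    ∀ᶠ y in 𝓝 (γ, γ), R.proj y.1 = R.proj y.2 →
      ∃ r ∈ N, R.tgtR r = R.srcL y.2 ∧ y.1 = R.actL r y.2 := by
  -- `R` has the subspace topology, so it suffices that the ambient quotient `y₁y₂⁻¹` is close to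
  -- the unit, which is continuity of division.
  obtain ⟨O, hO, hON⟩ := mem_nhds_induced _ _ _ |>.1 hN
  have hc : ContinuousWithinAt (fun p : Γ × Γ => G.mul p.1 p.2)
      {p | G.tgt p.1 = G.src p.2} ((γ : Γ), G.inv γ) :=
    (G.smooth_mul _ (G.src_inv _).symm).continuousWithinAt
  have hO' : O ∈ 𝓝 (G.mul γ (G.inv γ)) := by rw [G.mul_inv]; exact hO
  have h1 := eventually_nhdsWithin_iff.1 (hc.eventually hO')
  have hcont : ContinuousAt (fun y : R.bundle × R.bundle => ((y.1 : Γ), G.inv y.2)) (γ, γ) := by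
    have := G.smooth_inv.continuous
    fun_prop
  filter_upwards [hcont.eventually h1] with y hy hpy
  obtain ⟨r, r1, r2⟩ := R.proj_eq_iff.1 hpy
  have r1' : G.tgt r = G.src y.2 := congrArg Subtype.val r1
  refine ⟨r, hON ?_, r1, r2⟩
  have h2 : G.mul y.1 (G.inv y.2) ∈ O := hy (by rw [r2, R.tgt_actL, G.src_inv])
  rw [r2, coe_actL r1, G.mul_inv_cancel_right _ _ r1'] at h2
  exact h2

/-- The chart is `f (w, c) = ρ (src (σ w), c) · σ w`, for a slice `σ` complementary to the orbit of
`γ`. The equality of dimensions comes from the injectivity of the differential `B` of the orbit map.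
-/
theorem isFoliatedAt_proj [IsManifold (mdl 𝕜 n) ∞ R.bundle]
    (hP : Manifold.IsSmoothEmbedding (mdl 𝕜 n) (mdl 𝕜 g) ∞ (Subtype.val : R.bundle → Γ))
    (γ : R.bundle) :
    n - (R.arrows.dim - R.objects.dim) + (R.arrows.dim - R.objects.dim) = n ∧
      IsFoliatedAt 𝕜 n (n - (R.arrows.dim - R.objects.dim)) (R.arrows.dim - R.objects.dim)
        R.proj γ := by
  obtain ⟨ρ, κ, hρ, hκ, hκ0, hρκ, hκρ, hρ1⟩ := R.exists_unit_param (R.srcL γ)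
  generalize R.arrows.dim - R.objects.dim = k at *
  set χ := chartAt (Model 𝕜 n) γ
  have hχ : χ ∈ IsManifold.maximalAtlas (mdl 𝕜 n) ∞ R.bundle :=
    IsManifold.chart_mem_maximalAtlas γ
  have hγ : γ ∈ χ.source := mem_chart_source _ γ
  have hγρ : ρ (R.srcL γ, 0) = R.oneR (R.srcL γ) := hρ1.self_of_nhds
  -- the orbit map of `γ`
  have ho1 : ContMDiffNear (mdl 𝕜 k) (mdl 𝕜 R.arrows.dim) (fun c => ρ (R.srcL γ, c)) 0 :=
    hρ.comp_of_eq (ContMDiffNear.const.prodMk .id) rfl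
  have ht1 : ∀ᶠ c in 𝓝 (0 : Model 𝕜 k),
      R.tgtR (ρ (R.srcL γ, c)) = R.srcL γ ∧ κ (ρ (R.srcL γ, c)) = c := by
    have : ContinuousAt (fun c : Model 𝕜 k => (R.srcL γ, c)) 0 := by fun_prop
    exact this.eventually hκρ
  have ho2 : ContMDiffNear (mdl 𝕜 k) (mdl 𝕜 n) (fun c => R.actL (ρ (R.srcL γ, c)) γ) 0 :=
    contMDiffNear_actL hP ho1 .const (ht1.mono fun c hc => hc.1)
  have ho2_zero : R.actL (ρ (R.srcL γ, 0)) γ = γ := by rw [hγρ, R.actL_oneR]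
  have ho3 : ContMDiffNear (mdl 𝕜 k) (mdl 𝕜 n) (fun c => χ (R.actL (ρ (R.srcL γ, c)) γ)) 0 :=
    ContMDiffNear.comp_of_eq (.of_mem_maximalAtlas hχ hγ) ho2 ho2_zero
  have hdB := ho3.contMDiffAt.contDiffAt.differentiableAt (by simp)
  set B := fderiv 𝕜 (fun c => χ (R.actL (ρ (R.srcL γ, c)) γ)) 0 with hBdef
  -- Composing the orbit map with the local left inverse `l` gives `κ ∘ ρ`, which is the identity in
  -- `c`.
  have hB : Function.Injective B := by
    obtain ⟨l, hl, hl'⟩ := exists_leftInverse_actL hP γ hκ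
    have h1 : ContMDiffNear (mdl 𝕜 n) (mdl 𝕜 k) (fun v => l (χ.symm v)) (χ γ) :=
      hl.comp_of_eq (.of_symm_mem_maximalAtlas hχ (χ.map_source hγ)) (χ.left_inv hγ)
    have h2 := (h1.contMDiffAt.contDiffAt.differentiableAt (by simp)).hasFDerivAt
    have h3 : HasFDerivAt (fun c => χ (R.actL (ρ (R.srcL γ, c)) γ)) B 0 := hdB.hasFDerivAt
    have h4 := HasFDerivAt.comp (𝕜 := 𝕜) (g := fun v => l (χ.symm v))
      (0 : Model 𝕜 k) (by rw [ho2_zero]; exact h2) h3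
    have hl'' : ∀ᶠ r in 𝓝 (ρ (R.srcL γ, 0)), R.tgtR r = R.srcL γ → l (R.actL r γ) = κ r := by
      rwa [hγρ]
    have hsrc : χ.source ∈ 𝓝 (R.actL (ρ (R.srcL γ, 0)) γ) := by
      rw [ho2_zero]; exact χ.open_source.mem_nhds hγ
    have h5 : (fun v => l (χ.symm v)) ∘ (fun c => χ (R.actL (ρ (R.srcL γ, c)) γ))
        =ᶠ[𝓝 0] _root_.id := by
      filter_upwards [ho1.continuousAt.eventually hl'', ht1,
        ho2.continuousAt.eventually hsrc] with c hc1 hc2 hc3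
      simp only [Function.comp, _root_.id]
      rw [χ.left_inv hc3, hc1 hc2.1, hc2.2]
    have h6 := (h4.congr_of_eventuallyEq h5.symm).unique (hasFDerivAt_id (0 : Model 𝕜 k))
    intro c c' hcc
    have h7 := congrArg (fun A : Model 𝕜 k →L[𝕜] Model 𝕜 k => A c) h6
    have h8 := congrArg (fun A : Model 𝕜 k →L[𝕜] Model 𝕜 k => A c') h6
    simp only [ContinuousLinearMap.comp_apply, ContinuousLinearMap.id_apply] at h7 h8
    rw [← h7, ← h8, hcc]
  obtain ⟨d, hd, hnk, ι, D, hD⟩ : ∃ d, n - k = d ∧ d + k = n ∧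
      ∃ (ι : Model 𝕜 d →L[𝕜] Model 𝕜 n) (D : (Model 𝕜 d × Model 𝕜 k) ≃L[𝕜] Model 𝕜 n),
        ∀ w c, D (w, c) = ι w + B c := ⟨_, rfl, exists_complementary_map B hB⟩
  rw [hd]
  refine ⟨hnk, ?_⟩
  -- the transverse slice
  let σ : Model 𝕜 d → R.bundle := fun w => χ.symm (χ γ + ι w)
  have hσ0 : σ 0 = γ := by simp [σ, χ.left_inv hγ]
  have hlin : ContMDiffNear (mdl 𝕜 d) (mdl 𝕜 n) (fun w => χ γ + ι w) 0 :=
    ContDiff.contMDiffNear (by fun_prop) 0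
  have hσ : ContMDiffNear (mdl 𝕜 d) (mdl 𝕜 n) σ 0 :=
    ContMDiffNear.comp_of_eq (.of_symm_mem_maximalAtlas hχ (χ.map_source hγ)) hlin (by simp)
  have hχσ : ∀ᶠ w in 𝓝 (0 : Model 𝕜 d), χ (σ w) = χ γ + ι w := by
    have : χ.target ∈ 𝓝 (χ γ + ι 0) := by
      simpa using χ.open_target.mem_nhds (χ.map_source hγ)
    filter_upwards [hlin.continuousAt.eventually this] with w hw
    exact χ.right_inv hw
  have hsσ : ContMDiffNear (mdl 𝕜 d) (mdl 𝕜 R.objects.dim) (fun w => R.srcL (σ w)) 0 :=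
    ((contMDiff_srcL hP).contMDiffNear _).comp hσ
  -- the local parametrization
  have hfst : ContMDiffNear 𝓘(𝕜, Model 𝕜 d × Model 𝕜 k) (mdl 𝕜 d)
    (Prod.fst : Model 𝕜 d × Model 𝕜 k → Model 𝕜 d) 0 := contDiff_fst.contMDiffNear 0
  have hsnd : ContMDiffNear 𝓘(𝕜, Model 𝕜 d × Model 𝕜 k) (mdl 𝕜 k)
    (Prod.snd : Model 𝕜 d × Model 𝕜 k → Model 𝕜 k) 0 := contDiff_snd.contMDiffNear 0
  have hρin : ContMDiffNear 𝓘(𝕜, Model 𝕜 d × Model 𝕜 k)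
      ((mdl 𝕜 R.objects.dim).prod (mdl 𝕜 k))
      (fun v : Model 𝕜 d × Model 𝕜 k => (R.srcL (σ v.1), v.2)) 0 :=
    (hsσ.comp_of_eq hfst rfl).prodMk hsnd
  have hin0 : (R.srcL (σ (0 : Model 𝕜 d × Model 𝕜 k).1), (0 : Model 𝕜 d × Model 𝕜 k).2) =
      (R.srcL γ, 0) := by rw [Prod.fst_zero, hσ0, Prod.snd_zero]
  have hρσ := hρ.comp_of_eq hρin hin0
  have htσ : ∀ᶠ v in 𝓝 (0 : Model 𝕜 d × Model 𝕜 k),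
      R.tgtR (ρ (R.srcL (σ v.1), v.2)) = R.srcL (σ v.1) := by
    have h1 := hρin.continuousAt.eventually (p := fun p => R.tgtR (ρ p) = p.1 ∧ κ (ρ p) = p.2)
      (by simpa [hσ0] using hκρ)
    exact h1.mono fun v hv => hv.1
  let f : Model 𝕜 d × Model 𝕜 k → R.bundle := fun v => R.actL (ρ (R.srcL (σ v.1), v.2)) (σ v.1)
  have hf : ContMDiffNear 𝓘(𝕜, Model 𝕜 d × Model 𝕜 k) (mdl 𝕜 n) f 0 :=
    contMDiffNear_actL hP hρσ (hσ.comp_of_eq hfst rfl) htσ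
  have hfσ : ∀ᶠ w in 𝓝 (0 : Model 𝕜 d), f (w, 0) = σ w := by
    have := hsσ.continuousAt.eventually (p := fun y => ρ (y, 0) = R.oneR y)
      (by simpa only [hσ0] using hρ1)
    filter_upwards [this] with w hw
    simp only [f]
    rw [hw, R.actL_oneR]
  have hf0 : f 0 = γ := by
    have := hfσ.self_of_nhds
    rw [hσ0] at this
    exact this
  have hχf : ContMDiffNear 𝓘(𝕜, Model 𝕜 d × Model 𝕜 k) (mdl 𝕜 n) (fun v => χ (f v)) 0 :=
    ContMDiffNear.comp_of_eq (.of_mem_maximalAtlas hχ hγ) hf hf0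
  have hder : HasFDerivAt (fun v => χ (f v))
      (D : (Model 𝕜 d × Model 𝕜 k) →L[𝕜] Model 𝕜 n) 0 := by
    have h1 := (hχf.contMDiffAt.contDiffAt.differentiableAt (by simp)).hasFDerivAt
    set D' := fderiv 𝕜 (fun v => χ (f v)) 0
    -- On `c = 0` the map `f` is the slice, with differential `ι`; on `w = 0` it is the orbit map of
    -- `γ`, with differential `B`.
    have h2 : D'.comp (ContinuousLinearMap.inl 𝕜 (Model 𝕜 d) (Model 𝕜 k)) = ι := by
      have a1 : HasFDerivAt (fun w : Model 𝕜 d => χ (f (w, 0)))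
          (D'.comp (ContinuousLinearMap.inl 𝕜 (Model 𝕜 d) (Model 𝕜 k))) 0 :=
        HasFDerivAt.comp (𝕜 := 𝕜) (g := fun v => χ (f v)) (0 : Model 𝕜 d) h1
          (ContinuousLinearMap.inl 𝕜 (Model 𝕜 d) (Model 𝕜 k)).hasFDerivAt
      have a2 : HasFDerivAt (fun w : Model 𝕜 d => χ γ + ι w) ι 0 := ι.hasFDerivAt.const_add _
      refine (a1.congr_of_eventuallyEq ?_).unique a2
      filter_upwards [hfσ, hχσ] with w hw hw'
      rw [hw, hw']
    have h3 : D'.comp (ContinuousLinearMap.inr 𝕜 (Model 𝕜 d) (Model 𝕜 k)) = B := by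
      have a1 : HasFDerivAt (fun c : Model 𝕜 k => χ (f (0, c)))
          (D'.comp (ContinuousLinearMap.inr 𝕜 (Model 𝕜 d) (Model 𝕜 k))) 0 :=
        HasFDerivAt.comp (𝕜 := 𝕜) (g := fun v => χ (f v)) (0 : Model 𝕜 k) h1
          (ContinuousLinearMap.inr 𝕜 (Model 𝕜 d) (Model 𝕜 k)).hasFDerivAt
      have a2 : (fun c : Model 𝕜 k => χ (f (0, c))) =
          fun c => χ (R.actL (ρ (R.srcL γ, c)) γ) := by
        funext c; simp only [f, hσ0]
      rw [a2] at a1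
      exact a1.unique hdB.hasFDerivAt
    have h4 : D' = (D : (Model 𝕜 d × Model 𝕜 k) →L[𝕜] Model 𝕜 n) := by
      refine ContinuousLinearMap.ext fun ⟨w, c⟩ => ?_
      have e1 : D' (w, c) = D' (w, 0) + D' (0, c) := by rw [← map_add]; simp
      have e2 : D' (w, 0) = ι w := by rw [← h2]; rfl
      have e3 : D' (0, c) = B c := by rw [← h3]; rfl
      rw [e1, e2, e3, ← hD]; rfl
    rw [← h4]
    exact h1
  obtain ⟨h, h0, hhf, hs1, hs2⟩ :=
    hf.exists_openPartialHomeomorph hχ (by rw [hf0]; exact hγ) hder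
  -- shrinking the domain to a product
  obtain ⟨U₀, hU₀, U₁, hU₁, hUs⟩ := mem_nhds_prod_iff.1 (h.open_source.mem_nhds h0)
  have hN : {r | ρ (R.tgtR r, κ r) = r ∧ κ r ∈ U₁} ∈ 𝓝 (R.oneR (R.srcL γ)) := by
    have hU₁' : U₁ ∈ 𝓝 (κ (R.oneR (R.srcL γ))) := by rw [hκ0]; exact hU₁
    exact hρκ.and (hκ.continuousAt.eventually hU₁')
  -- If `σ w₁ = r · σ w₂` with `r` close to a unit, then `f (w₁, 0) = f (w₂, κ r)`, and injectivity
  -- of the chart gives `w₁ = w₂`.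
  have hinj : ∀ᶠ w in 𝓝 ((0 : Model 𝕜 d), (0 : Model 𝕜 d)), w.1 ∈ U₀ → w.2 ∈ U₀ →
      f (w.1, 0) = σ w.1 → R.proj (σ w.1) = R.proj (σ w.2) → w.1 = w.2 := by
    have hc : ContinuousAt (fun w : Model 𝕜 d × Model 𝕜 d => (σ w.1, σ w.2)) (0, 0) :=
      (ContinuousAt.comp (g := σ) (f := Prod.fst) hσ.continuousAt continuousAt_fst).prodMk
        (ContinuousAt.comp (g := σ) (f := Prod.snd) hσ.continuousAt continuousAt_snd)
    have hE := hc.eventually (p := fun y => R.proj y.1 = R.proj y.2 →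
      ∃ r ∈ {r | ρ (R.tgtR r, κ r) = r ∧ κ r ∈ U₁}, R.tgtR r = R.srcL y.2 ∧ y.1 = R.actL r y.2)
      (by simp only [hσ0]; exact eventually_exists_actL γ hN)
    filter_upwards [hE] with w hw hw1 hw2 hfw hpw
    obtain ⟨r, ⟨r1, r2⟩, r3, r4⟩ := hw hpw
    have e1 : f (w.2, κ r) = σ w.1 := by
      simp only [f]
      rw [← r3, r1, ← r4]
    have m1 : (w.1, (0 : Model 𝕜 k)) ∈ h.source := hUs ⟨hw1, mem_of_mem_nhds hU₁⟩
    have m2 : (w.2, κ r) ∈ h.source := hUs ⟨hw2, r2⟩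
    have := h.injOn m1 m2 (by rw [hhf _ m1, hhf _ m2, hfw, e1])
    exact congrArg Prod.fst this
  obtain ⟨V₀, hV₀, V₁, hV₁, hV⟩ := mem_nhds_prod_iff.1 hinj
  -- A product domain containing `0` allows height `0` for every plaque; `O` lies in both `V₀` and
  -- `V₁`, so `hinj` applies to any two of its points.
  obtain ⟨O, hOs, hO, hO0⟩ := mem_nhds_iff.1
    (Filter.inter_mem (Filter.inter_mem hV₀ hV₁) (Filter.inter_mem hU₀ hfσ))
  obtain ⟨O', hOs', hO', hO0'⟩ := mem_nhds_iff.1 hU₁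
  have hOO : IsOpen (O ×ˢ O') := hO.prod hO'
  have hsource : (h.restr (O ×ˢ O')).source = O ×ˢ O' := by
    rw [h.restr_source' _ hOO]
    refine inter_eq_right.2 fun v hv => hUs ⟨(hOs hv.1).2.1, hOs' hv.2⟩
  have hpf : ∀ v, R.proj (f v) = R.proj (σ v.1) := fun v => R.proj_actL _ _
  have hph : ∀ v ∈ O ×ˢ O', R.proj (h v) = R.proj (σ v.1) := fun v hv => by
    rw [hhf v (hUs ⟨(hOs hv.1).2.1, hOs' hv.2⟩), hpf]
  refine ⟨h.restr (O ×ˢ O'), hs1.mono ?_, hs2.mono ?_, ?_, 0, ?_, ?_⟩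
  · rw [h.restr_source' _ hOO]; exact inter_subset_left
  · exact inter_subset_left
  · have : h 0 = γ := by rw [hhf 0 h0, hf0]
    have h00 : (0 : Model 𝕜 d × Model 𝕜 k) ∈ (h.restr (O ×ˢ O')).source := by
      rw [hsource]; exact ⟨hO0, hO0'⟩
    have := (h.restr (O ×ˢ O')).map_source h00
    rwa [OpenPartialHomeomorph.restr_apply, hhf 0 h0, hf0] at this
  · rw [hsource]
    exact fun v hv => ⟨hv.1, hO0'⟩
  · rw [hsource]
    intro v hv v' hv'
    rw [OpenPartialHomeomorph.restr_apply, hph v hv, hph v' hv']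
    refine ⟨fun hpp => ?_, fun hvv => by rw [hvv]⟩
    exact hV (a := (v.1, v'.1)) ⟨(hOs hv.1).1.1, (hOs hv'.1).1.2⟩ (hOs hv.1).2.1 (hOs hv'.1).2.1
      (hOs hv.1).2.2 hpp

/-- `Z(R)` is a manifold for which `Γ_L → Z(R)` is a submersion. -/
theorem exists_manifold_Z [IsManifold (mdl 𝕜 n) ∞ R.bundle]
    (hP : Manifold.IsSmoothEmbedding (mdl 𝕜 n) (mdl 𝕜 g) ∞ (Subtype.val : R.bundle → Γ)) :
    ∃ (d : ℕ) (_ : ChartedSpace (Model 𝕜 d) R.Z), IsManifold (mdl 𝕜 d) ∞ R.Z ∧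
      Manifold.IsSubmersion (mdl 𝕜 n) (mdl 𝕜 d) ∞ R.proj := by
  -- The inequality of dimensions is read off at a point; for empty `Γ_L` any dimension works.
  rcases isEmpty_or_nonempty R.bundle with h | ⟨⟨γ⟩⟩
  · exact ⟨n, exists_quotient_manifold (k := 0) rfl (isOpenQuotientMap_proj hP)
      (fun x => h.elim x) fun x => h.elim x⟩
  · exact ⟨_, exists_quotient_manifold (isFoliatedAt_proj hP γ).1 (isOpenQuotientMap_proj hP)
      (fun x => (isFoliatedAt_proj hP x).2) (exists_transport hP)⟩

end LieSubgroupoid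

end Slice

end

noncomputable section

variable {𝕜 : Type} [RCLike 𝕜]

section Topology

/-- A subset which is a slice near each of its points is open in its closure. -/
theorem IsSliceAt.exists_isOpen {n k c : ℕ} {N : Type*} [TopologicalSpace N]
    [ChartedSpace (Model 𝕜 n) N] {A : Set N} {x : N} (h : IsSliceAt 𝕜 n k c A x) :
    ∃ U, IsOpen U ∧ x ∈ U ∧ U ∩ closure A ⊆ A := by
  obtain ⟨Θ, -, hx, e, he⟩ := h
  refine ⟨Θ.source, Θ.open_source, hx, fun y ⟨hy, hyA⟩ => ?_⟩
  rw [he y hy]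
  by_contra hne
  have hc : ContinuousAt (fun y => (e (Θ y)).2) y :=
    (continuous_snd.comp e.continuous).continuousAt.comp (Θ.continuousAt hy)
  have h1 : ∀ᶠ y' in 𝓝 y, (e (Θ y')).2 ≠ 0 ∧ y' ∈ Θ.source :=
    (hc.eventually_ne hne).and (Θ.open_source.mem_nhds hy)
  obtain ⟨y', ⟨h2, h3⟩, h4⟩ := mem_closure_iff_nhds.1 hyA _ h1
  exact h2 ((he y' h3).1 h4)

end Topology

/-! ### The map `φ`, the right action, separation, density and properness. -/

section Groupoid

variable {g m : ℕ} {Γ M : Type*}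
  [TopologicalSpace Γ] [ChartedSpace (Model 𝕜 g) Γ]
  [TopologicalSpace M] [ChartedSpace (Model 𝕜 m) M]

/-- The closure of a stable subset is stable. -/
theorem LieGroupoid.orbit_subset_closure (G : LieGroupoid 𝕜 g m Γ M) {S : Set M}
    (hS : G.IsStable S) {x : M} (hx : x ∈ closure S) : G.orbit x ⊆ closure S := by
  rintro _ ⟨γ, rfl, rfl⟩
  rw [mem_closure_iff] at hx ⊢
  intro V hV hγ
  -- The sources of the arrows ending in `V` form a neighbourhood of the source of `γ`, as the
  -- source map is open; it meets `S`.
  obtain ⟨_, ⟨γ', h1, rfl⟩, h2⟩ := hx _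
    (G.src_submersion.isOpenMap _ (hV.preimage G.tgt_submersion.contMDiff.continuous))
    (mem_image_of_mem _ hγ)
  exact ⟨_, h1, (hS γ').2 h2⟩

namespace LieSubgroupoid

variable {G : LieGroupoid 𝕜 g m Γ M} {R : LieSubgroupoid G}

variable (R) in
/-- The map `Z(R) → M` induced by the target map. -/
def phi (z : R.Z) : M :=
  Quotient.lift (fun γ : R.bundle => G.tgt γ) (by
    rintro γ γ' ⟨r, -, h, e⟩
    rw [e, G.tgt_mul _ _ h]) z

theorem phi_proj (γ : R.bundle) : R.phi (R.proj γ) = G.tgt γ := rfl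

variable (R) in
theorem proj_surjective : Function.Surjective R.proj := Quotient.mk_surjective

open Classical in
variable (R) in
/-- The right action of `Γ` on `Γ_L`. -/
def mulR (γ : R.bundle) (γ' : Γ) : R.bundle :=
  if h : G.tgt γ = G.src γ' then
    ⟨G.mul γ γ', by
      change G.src (G.mul γ γ') ∈ R.objects.carrier
      rw [G.src_mul _ _ h]
      exact γ.2⟩
  else γ

theorem coe_mulR {γ : R.bundle} {γ' : Γ} (h : G.tgt γ = G.src γ') :
    (R.mulR γ γ' : Γ) = G.mul γ γ' := by
  rw [mulR, dif_pos h]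

/-- By associativity the same arrow of `R` relates the two products. This makes the choice of
representative in `actZ` harmless. -/
theorem proj_mulR_congr {γ₁ γ₂ : R.bundle} (h : R.proj γ₁ = R.proj γ₂) {γ' : Γ}
    (h₂ : G.tgt γ₂ = G.src γ') : R.proj (R.mulR γ₁ γ') = R.proj (R.mulR γ₂ γ') := by
  obtain ⟨r, hr, e⟩ := R.proj_eq_iff.1 h
  have h₁ : G.tgt γ₁ = G.src γ' := by rw [e, R.tgt_actL, h₂]
  have hr' : G.tgt r = G.src γ₂ := congrArg Subtype.val hr
  have hr'' : R.tgtR r = R.srcL (R.mulR γ₂ γ') := by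
    rw [hr]
    exact Subtype.ext (by
      change G.src γ₂ = G.src (R.mulR γ₂ γ')
      rw [coe_mulR h₂, G.src_mul _ _ h₂])
  refine R.proj_eq_iff.2 ⟨r, hr'', Subtype.ext ?_⟩
  rw [coe_mulR h₁, coe_actL hr'', coe_mulR h₂, e, coe_actL hr, G.mul_assoc _ _ _ hr' h₂]

variable (R) in
/-- The right action of `Γ` on `Z(R)`. -/
def actZ (z : R.Z) (γ' : Γ) : R.Z := R.proj (R.mulR z.out γ')

theorem actZ_proj {γ : R.bundle} {γ' : Γ} (h : G.tgt γ = G.src γ') :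
    R.actZ (R.proj γ) γ' = R.proj (R.mulR γ γ') :=
  proj_mulR_congr (Quotient.out_eq (R.proj γ)) h

/-- The relation is the preimage of `R` under `(γ, γ') ↦ γγ'⁻¹`, a continuous map to `Γ_L^L` from
the pairs with equal targets; these pairs form a closed set because `M` is Hausdorff. -/
theorem isClosed_proj_eq [T2Space M] (hR : R.IsClosed) :
    _root_.IsClosed {q : R.bundle × R.bundle | R.proj q.1 = R.proj q.2} := by
  have ht : Continuous fun γ : R.bundle => G.tgt γ :=
    G.tgt_submersion.contMDiff.continuous.comp continuous_subtype_val
  let D : Set (R.bundle × R.bundle) := {q | G.tgt q.1 = G.tgt q.2}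
  have hD : _root_.IsClosed D :=
    isClosed_eq (ht.comp continuous_fst) (ht.comp continuous_snd)
  have hcomp : ∀ q : D, G.tgt q.1.1 = G.src (G.inv q.1.2) := fun q => by
    rw [G.src_inv]; exact q.2
  let f : D → {γ : Γ // G.src γ ∈ R.objects.carrier ∧ G.tgt γ ∈ R.objects.carrier} := fun q =>
    ⟨G.mul q.1.1 (G.inv q.1.2), by rw [G.src_mul _ _ (hcomp q)]; exact q.1.1.2,
      by rw [G.tgt_mul _ _ (hcomp q), G.tgt_inv]; exact q.1.2.2⟩
  have hf : Continuous f := by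
    refine Continuous.subtype_mk ?_ _
    have hi := G.smooth_inv.continuous
    exact G.smooth_mul.continuousOn.comp_continuous
      (f := fun q : D => ((q.1.1 : Γ), G.inv q.1.2)) (by fun_prop) hcomp
  have h1 : _root_.IsClosed (f ⁻¹' (Subtype.val ⁻¹' R.arrows.carrier)) := IsClosed.preimage hf hR
  convert! hD.isClosedMap_subtype_val _ h1 using 1
  ext ⟨γ, γ'⟩
  constructor
  · intro h
    obtain ⟨r, hr, e⟩ := R.proj_eq_iff.1 h
    have ht' : G.tgt γ = G.tgt γ' := by
      change R.phi (R.proj γ) = R.phi (R.proj γ')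
      exact congrArg _ h
    refine ⟨⟨(γ, γ'), ht'⟩, ?_, rfl⟩
    change G.mul γ (G.inv γ') ∈ R.arrows.carrier
    have e : γ = R.actL r γ' := e
    rw [e, coe_actL hr, G.mul_inv_cancel_right _ _ (congrArg Subtype.val hr)]
    exact r.2
  · rintro ⟨⟨⟨γ₁, γ₂⟩, hq⟩, hmem, heq⟩
    obtain ⟨rfl, rfl⟩ := Prod.mk.inj heq
    have hq' : G.tgt γ₁ = G.tgt γ₂ := hq
    refine Quotient.sound ⟨G.mul γ₁ (G.inv γ₂), hmem, ?_, ?_⟩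
    · rw [G.tgt_mul _ _ (by rw [G.src_inv, hq']), G.tgt_inv]
    · rw [G.mul_assoc _ _ _ (by rw [G.src_inv, hq']) (G.tgt_inv _), G.inv_mul, ← hq', G.mul_one]

variable {S : EmbeddedSubmanifold 𝕜 m M}

theorem objects_subset_closure (hRS : R.IsIn S) : R.objects.carrier ⊆ closure S.carrier := by
  intro x hx
  exact map_mem_closure continuous_subtype_val (hRS.dense ⟨x, hx⟩) fun y hy => hy

/-- An embedded submanifold is open in its closure, and here the closure contains `L`. -/
theorem isOpen_objects_inter (hRS : R.IsIn S) :
    IsOpen (Subtype.val ⁻¹' S.carrier : Set R.objects.carrier) := by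
  rw [isOpen_iff_mem_nhds]
  intro x hx
  obtain ⟨U, hU, hxU, hUS⟩ := (S.isSmoothEmbedding.isSliceAt hx).exists_isOpen
  filter_upwards [(hU.preimage continuous_subtype_val).mem_nhds hxU] with y hy
  exact hUS ⟨hy, objects_subset_closure hRS y.2⟩

theorem preimage_proj_phi (hS : G.IsStable S.carrier) :
    R.proj ⁻¹' (R.phi ⁻¹' S.carrier) = R.srcL ⁻¹' (Subtype.val ⁻¹' S.carrier) := by
  ext γ
  exact hS γ

variable (R) in
theorem isOpenMap_srcL : IsOpenMap R.srcL := by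
  have := G.src_submersion.isOpenMap.restrictPreimage R.objects.carrier
  exact this

theorem isOpen_phi_preimage (hS : G.IsStable S.carrier) (hRS : R.IsIn S)
    (hp : IsOpenQuotientMap R.proj) : IsOpen (R.phi ⁻¹' S.carrier) := by
  rw [← hp.isQuotientMap.isOpen_preimage, preimage_proj_phi hS]
  refine (isOpen_objects_inter hRS).preimage ?_
  exact Continuous.subtype_mk
    (G.src_submersion.contMDiff.continuous.comp continuous_subtype_val) _

/-- Pulled back to `Γ_L`, the set becomes the preimage of `L ∩ S` under the open source map, and
open maps pull dense sets back to dense sets. -/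
theorem dense_phi_preimage (hS : G.IsStable S.carrier) (hRS : R.IsIn S)
    (hp : IsOpenQuotientMap R.proj) : Dense (R.phi ⁻¹' S.carrier) := by
  rw [← hp.dense_preimage_iff, preimage_proj_phi hS]
  exact hRS.dense.preimage (isOpenMap_srcL R)

/-- If two arrows of `Γ_L` have the same target in `S`, their quotient joins two points of `L ∩ S`
by stability, so fullness puts it in `R`. -/
theorem phi_injOn (hS : G.IsStable S.carrier) (hRS : R.IsFullIn S) :
    InjOn R.phi (R.phi ⁻¹' S.carrier) := by
  intro z hz z' hz' h
  obtain ⟨γ, rfl⟩ := R.proj_surjective z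
  obtain ⟨γ', rfl⟩ := R.proj_surjective z'
  have hz : G.tgt γ ∈ S.carrier := hz
  have hz' : G.tgt γ' ∈ S.carrier := hz'
  have h : G.tgt γ = G.tgt γ' := h
  have hc : G.tgt γ = G.src (G.inv γ') := by rw [G.src_inv, h]
  refine Quotient.sound ⟨G.mul γ (G.inv γ'), hRS.full _ ?_ ?_, ?_, ?_⟩
  · rw [G.src_mul _ _ hc]
    exact ⟨γ.2, (hS _).1 hz⟩
  · rw [G.tgt_mul _ _ hc, G.tgt_inv]
    exact ⟨γ'.2, (hS _).1 hz'⟩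
  · rw [G.tgt_mul _ _ hc, G.tgt_inv]
  · rw [G.mul_assoc _ _ _ hc (G.tgt_inv _), G.inv_mul, ← h, G.mul_one]

theorem mem_range_phi {x : M} (h : (R.objects.carrier ∩ G.orbit x).Nonempty) :
    ∃ γ : R.bundle, G.tgt γ = x := by
  obtain ⟨y, hy, γ, rfl, rfl⟩ := h
  exact ⟨⟨G.inv γ, by
    change G.src (G.inv γ) ∈ R.objects.carrier
    rwa [G.src_inv]⟩, G.tgt_inv γ⟩

/-- The preimage is the continuous image of the compact quotient `R \ Γ_L^K`, once `K` is cut down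
to the closure of `S`, where `φ` takes its values. -/
theorem isCompact_phi_preimage (hprop : R.IsProperIn S)
    (hcl : ∀ z, R.phi z ∈ closure S.carrier) {K : Set M} (hK : IsCompact K) :
    IsCompact (R.phi ⁻¹' K) := by
  have hK' := hK.inter_right (isClosed_closure (s := S.carrier))
  have := hprop _ hK' inter_subset_right
  let f : Quotient (R.orbitSetoidOver (K ∩ closure S.carrier)) → R.Z :=
    Quotient.lift (fun γ => R.proj γ.1) fun γ γ' h => Quotient.sound h
  have hf : Continuous f :=
    Continuous.quotient_lift (continuous_quotient_mk'.comp continuous_subtype_val) _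
  convert! isCompact_range hf using 1
  ext z
  obtain ⟨γ, rfl⟩ := R.proj_surjective z
  constructor
  · intro hz
    exact ⟨Quotient.mk _ ⟨γ, hz, hcl (R.proj γ)⟩, rfl⟩
  · rintro ⟨q, hq⟩
    obtain ⟨⟨γ', h1, _⟩, rfl⟩ := Quotient.mk_surjective q
    change R.phi (R.proj γ) ∈ K
    rw [← hq]
    exact h1

section Smooth

variable {n d : ℕ} [ChartedSpace (Model 𝕜 n) R.bundle] [ChartedSpace (Model 𝕜 d) R.Z]

/-- Locally `φ` is the target map composed with a smooth section of the projection. -/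
theorem contMDiff_phi
    (hP : Manifold.IsSmoothEmbedding (mdl 𝕜 n) (mdl 𝕜 g) ∞ (Subtype.val : R.bundle → Γ))
    (hp : Manifold.IsSubmersion (mdl 𝕜 n) (mdl 𝕜 d) ∞ R.proj) :
    ContMDiff (mdl 𝕜 d) (mdl 𝕜 m) ∞ R.phi := by
  intro z
  obtain ⟨γ, rfl⟩ := R.proj_surjective z
  obtain ⟨σ, s1, s2, s3⟩ := (hp.isSubmersionAt γ).exists_section
  have h1 : ContMDiffAt (mdl 𝕜 d) (mdl 𝕜 m) ∞ (fun z => G.tgt (σ z)) (R.proj γ) :=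
    ((G.tgt_submersion.contMDiff.comp hP.contMDiff) _).comp _ s1.contMDiffAt
  refine h1.congr_of_eventuallyEq ?_
  filter_upwards [s3] with z hz
  conv_lhs => rw [← hz]
  rfl

variable (R) in
/-- The right `Γ`-module structure of `Z(R)`. -/
theorem nonempty_rightModule
    (hP : Manifold.IsSmoothEmbedding (mdl 𝕜 n) (mdl 𝕜 g) ∞ (Subtype.val : R.bundle → Γ))
    (hp : Manifold.IsSubmersion (mdl 𝕜 n) (mdl 𝕜 d) ∞ R.proj) :
    Nonempty (G.RightModule d R.phi) := by
  refine ⟨⟨R.actZ, contMDiff_phi hP hp, ?_, ?_, ?_, ?_⟩⟩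
  · intro z γ' h
    obtain ⟨γ, rfl⟩ := R.proj_surjective z
    have h : G.tgt γ = G.src γ' := h
    rw [actZ_proj h, phi_proj, coe_mulR h, G.tgt_mul _ _ h]
  · intro z
    obtain ⟨γ, rfl⟩ := R.proj_surjective z
    have h : G.tgt γ = G.src (G.one (G.tgt γ)) := (G.src_one _).symm
    rw [phi_proj, actZ_proj h]
    congr 1
    exact Subtype.ext (by rw [coe_mulR h, G.mul_one])
  · intro z γ₁ γ₂ h1 h2
    obtain ⟨γ, rfl⟩ := R.proj_surjective z
    have h1 : G.tgt γ = G.src γ₁ := h1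
    have h12 : G.tgt γ = G.src (G.mul γ₁ γ₂) := by rw [G.src_mul _ _ h2, h1]
    have h3 : G.tgt (R.mulR γ γ₁) = G.src γ₂ := by rw [coe_mulR h1, G.tgt_mul _ _ h1, h2]
    rw [actZ_proj h12, actZ_proj h1, actZ_proj h3]
    congr 1
    exact Subtype.ext (by
      rw [coe_mulR h12, coe_mulR h3, coe_mulR h1, G.mul_assoc _ _ _ h1 h2])
  · rintro ⟨z, γ'⟩ hz
    obtain ⟨γ, rfl⟩ := R.proj_surjective z
    -- With a local section `σ` of the projection, the action becomes `(z, γ') ↦ proj (σ z · γ')` on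
    -- the fibre product.
    obtain ⟨σ, s1, s2, s3⟩ := (hp.isSubmersionAt γ).exists_section
    set C : Set (R.Z × Γ) := {p | R.phi p.1 = G.src p.2}
    have hfst : ContMDiffWithinAt ((mdl 𝕜 d).prod (mdl 𝕜 g)) (mdl 𝕜 n) ∞
        (fun p : R.Z × Γ => σ p.1) C (R.proj γ, γ') :=
      (ContMDiffAt.comp (g := σ) (R.proj γ, γ') s1.contMDiffAt contMDiffAt_fst).contMDiffWithinAt
    have hev : ∀ᶠ p in 𝓝[C] (R.proj γ, γ'), R.proj (σ p.1) = p.1 ∧ G.tgt (σ p.1) = G.src p.2 := by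
      have h1 : ContinuousAt (Prod.fst : R.Z × Γ → R.Z) (R.proj γ, γ') := continuousAt_fst
      filter_upwards [nhdsWithin_le_nhds (h1.eventually s3), self_mem_nhdsWithin] with p hp hpC
      have hpC : R.phi p.1 = G.src p.2 := hpC
      refine ⟨hp, ?_⟩
      rw [← phi_proj, hp, hpC]
    have hmul : ContMDiffWithinAt ((mdl 𝕜 d).prod (mdl 𝕜 g)) (mdl 𝕜 g) ∞
        (fun p : R.Z × Γ => G.mul (σ p.1) p.2) C (R.proj γ, γ') :=
      G.contMDiffWithinAt_mul hz (hP.contMDiff.contMDiffAt.comp_contMDiffWithinAt _ hfst)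
        contMDiffWithinAt_snd (hev.mono fun p hp => hp.2)
    have hmulR : ContMDiffWithinAt ((mdl 𝕜 d).prod (mdl 𝕜 g)) (mdl 𝕜 n) ∞
        (fun p : R.Z × Γ => R.mulR (σ p.1) p.2) C (R.proj γ, γ') := by
      refine hP.contMDiffWithinAt_of_val (hmul.congr_of_eventuallyEq_of_mem ?_ hz)
      exact hev.mono fun p hp => coe_mulR hp.2
    have hfin := hp.contMDiff.contMDiffAt.comp_contMDiffWithinAt _ hmulR
    refine hfin.congr_of_eventuallyEq_of_mem ?_ hz
    filter_upwards [hev] with p hp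
    have := actZ_proj hp.2
    rw [hp.1] at this
    exact this

end Smooth

end LieSubgroupoid

end Groupoid

end

noncomputable section

/-! ### Differentials as maps between model spaces. -/

section Derivative

variable {𝕜 : Type*} [NontriviallyNormedField 𝕜]
  {E E' E'' : Type*} [NormedAddCommGroup E] [NormedSpace 𝕜 E] [NormedAddCommGroup E']
  [NormedSpace 𝕜 E'] [NormedAddCommGroup E''] [NormedSpace 𝕜 E'']
  {H H' H'' : Type*} [TopologicalSpace H] [TopologicalSpace H'] [TopologicalSpace H'']
  {I : ModelWithCorners 𝕜 E H} {I' : ModelWithCorners 𝕜 E' H'} {I'' : ModelWithCorners 𝕜 E'' H''}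
  {X Y Z : Type*} [TopologicalSpace X] [ChartedSpace H X] [TopologicalSpace Y] [ChartedSpace H' Y]
  [TopologicalSpace Z] [ChartedSpace H'' Z]

/-- The chain rule, with differentials considered as maps between the model spaces. -/
theorem HasMFDerivAt.comp_model {g : Y → Z} {f : X → Y} {x : X} {y : Y} {Dg : E' →L[𝕜] E''}
    {Df : E →L[𝕜] E'} (hg : HasMFDerivAt I' I'' g y Dg) (hf : HasMFDerivAt I I' f x Df)
    (h : f x = y) : HasMFDerivAt I I'' (fun z => g (f z)) x (Dg.comp Df) := by
  subst h
  exact HasMFDerivAt.comp x hg hf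

theorem HasMFDerivAt.eq_of_eventuallyEq {f f₁ : X → Y} {x : X} {D D₁ : E →L[𝕜] E'}
    (hf : HasMFDerivAt I I' f x D) (hf₁ : HasMFDerivAt I I' f₁ x D₁) (h : f =ᶠ[𝓝 x] f₁) :
    D = D₁ :=
  hasMFDerivAt_unique hf (hf₁.congr_of_eventuallyEq h)

theorem HasMFDerivAt.prodMk_model {g : X → Z} {f : X → Y} {x : X} {Df : E →L[𝕜] E'}
    {Dg : E →L[𝕜] E''} (hf : HasMFDerivAt I I' f x Df) (hg : HasMFDerivAt I I'' g x Dg) :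
    HasMFDerivAt I (I'.prod I'') (fun z => (f z, g z)) x (Df.prod Dg) :=
  hf.prodMk hg

theorem ContMDiffNear.exists_hasMFDerivAt {f : X → Y} {x : X} (h : ContMDiffNear I I' f x) :
    ∃ D : E →L[𝕜] E', HasMFDerivAt I I' f x D := ⟨_, h.mdifferentiableAt.hasMFDerivAt⟩

end Derivative

variable {𝕜 : Type} [RCLike 𝕜]

/-! ### Transversality and local sections of the target map. -/

section Groupoid

variable {g m : ℕ} {Γ M : Type*}
  [TopologicalSpace Γ] [ChartedSpace (Model 𝕜 g) Γ]
  [TopologicalSpace M] [ChartedSpace (Model 𝕜 m) M]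

namespace LieSubgroupoid

variable {G : LieGroupoid 𝕜 g m Γ M} {R : LieSubgroupoid G} {S : EmbeddedSubmanifold 𝕜 m M}
  {n d : ℕ} [ChartedSpace (Model 𝕜 n) R.bundle]

/-- By transversality, the target map `Γ_L → S` has local sections near points of `L ∩ S`. -/
theorem exists_section_tgt (hS : G.IsStable S.carrier) (hRS : R.IsIn S)
    (hP : Manifold.IsSmoothEmbedding (mdl 𝕜 n) (mdl 𝕜 g) ∞ (Subtype.val : R.bundle → Γ))
    {x : M} (hxL : x ∈ R.objects.carrier) (hxS : x ∈ S.carrier) :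
    ∃ τ : S.carrier → R.bundle,
      ContMDiffNear (mdl 𝕜 S.dim) (mdl 𝕜 n) τ ⟨x, hxS⟩ ∧
      ∀ᶠ y in 𝓝 (⟨x, hxS⟩ : S.carrier), G.tgt (τ y) = y := by
  obtain ⟨-, hsub⟩ := (G.src_submersion.isSubmersionAt (G.one x)).model_complement
  obtain ⟨ρ, κ, hρ, hκ, hρκ, hκρ⟩ := hsub.exists_param
  rw [G.src_one] at hρ hκρ
  obtain ⟨rS, hrS, hrS'⟩ := S.isSmoothEmbedding.exists_retraction ⟨x, hxS⟩
  let xL : R.objects.carrier := ⟨x, hxL⟩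
  let xP : R.bundle := ⟨G.one x, by
    change G.src (G.one x) ∈ R.objects.carrier
    rwa [G.src_one]⟩
  obtain ⟨rP, hrP, hrP'⟩ := hP.exists_retraction xP
  set α := chartAt (Model 𝕜 R.objects.dim) xL
  have hα : α ∈ IsManifold.maximalAtlas (mdl 𝕜 R.objects.dim) ∞ R.objects.carrier :=
    IsManifold.chart_mem_maximalAtlas xL
  have hxα : xL ∈ α.source := mem_chart_source _ _
  have hαx : α.symm (α xL) = xL := α.left_inv hxα
  set c₀ := κ (G.one x)
  -- A chart of `L` for the source and a fibre coordinate `c` of the source map parametrize `Γ_L`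
  -- near the unit of `x`, which sits at `v₀`.
  let v₀ : Model 𝕜 R.objects.dim × Model 𝕜 (g - m) := (α xL, c₀)
  have hfst : ContMDiffNear 𝓘(𝕜, Model 𝕜 R.objects.dim × Model 𝕜 (g - m)) (mdl 𝕜 R.objects.dim)
    Prod.fst v₀ := contDiff_fst.contMDiffNear _
  have hsnd : ContMDiffNear 𝓘(𝕜, Model 𝕜 R.objects.dim × Model 𝕜 (g - m)) (mdl 𝕜 (g - m))
    Prod.snd v₀ := contDiff_snd.contMDiffNear _
  have hαs : ContMDiffNear 𝓘(𝕜, Model 𝕜 R.objects.dim × Model 𝕜 (g - m)) (mdl 𝕜 R.objects.dim)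
      (fun v => α.symm v.1) v₀ :=
    ContMDiffNear.comp_of_eq (.of_symm_mem_maximalAtlas hα (α.map_source hxα)) hfst rfl
  have hvL : ContMDiffNear (mdl 𝕜 R.objects.dim) (mdl 𝕜 m)
    (Subtype.val : R.objects.carrier → M) xL :=
    R.objects.isSmoothEmbedding.contMDiff.contMDiffNear _
  have hb : ContMDiffNear 𝓘(𝕜, Model 𝕜 R.objects.dim × Model 𝕜 (g - m)) (mdl 𝕜 m)
      (fun v => (α.symm v.1 : M)) v₀ := hvL.comp_of_eq hαs hαx
  have hbc := hb.prodMk hsnd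
  have hbc0 : ((α.symm v₀.1 : M), v₀.2) = (x, c₀) := by
    simp only [v₀, hαx]; rfl
  have hq : ContMDiffNear 𝓘(𝕜, Model 𝕜 R.objects.dim × Model 𝕜 (g - m)) (mdl 𝕜 g)
      (fun v => ρ ((α.symm v.1 : M), v.2)) v₀ := hρ.comp_of_eq hbc hbc0
  have hρ0 : ρ (x, c₀) = G.one x := by
    have := hρκ.self_of_nhds
    rwa [G.src_one] at this
  have hq0 : ρ ((α.symm v₀.1 : M), v₀.2) = G.one x := by rw [hbc0, hρ0]
  have hsrc : ∀ᶠ v in 𝓝 v₀, G.src (ρ ((α.symm v.1 : M), v.2)) = α.symm v.1 := by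
    have h1 := hbc.continuousAt.eventually (p := fun p => G.src (ρ p) = p.1 ∧ κ (ρ p) = p.2)
      (by beta_reduce; rw [hbc0]; exact hκρ)
    exact h1.mono fun v hv => hv.1
  have hqP : ContMDiffNear 𝓘(𝕜, Model 𝕜 R.objects.dim × Model 𝕜 (g - m)) (mdl 𝕜 n)
      (fun v => rP (ρ ((α.symm v.1 : M), v.2))) v₀ := hrP.comp_of_eq hq hq0
  have hqP' : ∀ᶠ v in 𝓝 v₀, (rP (ρ ((α.symm v.1 : M), v.2)) : Γ) = ρ ((α.symm v.1 : M), v.2) := by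
    obtain ⟨W, hW, hWP⟩ := mem_nhds_induced _ _ _ |>.1 hrP'
    filter_upwards [hsrc, hq.continuousAt.eventually (p := fun γ => γ ∈ W)
      (by beta_reduce; rw [hq0]; exact hW)] with v h1 h2
    have h3 : ρ ((α.symm v.1 : M), v.2) ∈ R.bundle := by
      change G.src _ ∈ R.objects.carrier
      rw [h1]
      exact Subtype.coe_prop _
    exact congrArg Subtype.val (hWP (a := ⟨_, h3⟩) h2)
  have ht := G.tgt_submersion.contMDiff.contMDiffNear (G.one x)
  have hh : ContMDiffNear 𝓘(𝕜, Model 𝕜 R.objects.dim × Model 𝕜 (g - m)) (mdl 𝕜 m)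
      (fun v => G.tgt (ρ ((α.symm v.1 : M), v.2))) v₀ := ht.comp_of_eq hq hq0
  have hh0 : G.tgt (ρ ((α.symm v₀.1 : M), v₀.2)) = x := by rw [hq0, G.tgt_one]
  have hη : ContMDiffNear 𝓘(𝕜, Model 𝕜 R.objects.dim × Model 𝕜 (g - m)) (mdl 𝕜 S.dim)
      (fun v => rS (G.tgt (ρ ((α.symm v.1 : M), v.2)))) v₀ := hrS.comp_of_eq hh hh0
  have hη0 : rS (G.tgt (ρ ((α.symm v₀.1 : M), v₀.2))) = ⟨x, hxS⟩ := by
    rw [hh0]; exact hrS'.self_of_nhds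
  have hη' : ∀ᶠ v in 𝓝 v₀, (rS (G.tgt (ρ ((α.symm v.1 : M), v.2))) : M) =
      G.tgt (ρ ((α.symm v.1 : M), v.2)) := by
    obtain ⟨W, hW, hWS⟩ := mem_nhds_induced _ _ _ |>.1 hrS'
    -- As `L ∩ S` is open in `L`, nearby sources stay in `S`; so do the targets by stability, and
    -- `rS` fixes them.
    have hSL : (Subtype.val ⁻¹' S.carrier : Set R.objects.carrier) ∈ 𝓝 (α.symm v₀.1) := by
      refine (isOpen_objects_inter hRS).mem_nhds ?_
      change ((α.symm (α xL) : R.objects.carrier) : M) ∈ S.carrier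
      rw [hαx]; exact hxS
    filter_upwards [hsrc, hαs.continuousAt.eventually hSL,
      hh.continuousAt.eventually (p := fun y => y ∈ W)
        (by beta_reduce; rw [hh0]; exact hW)] with v h1 h2 h3
    have h4 : G.tgt (ρ ((α.symm v.1 : M), v.2)) ∈ S.carrier := by
      rw [hS, h1]; exact h2
    exact congrArg Subtype.val (hWS (a := ⟨_, h4⟩) h3)
  -- the differential of `η` is surjective
  have hvS : ContMDiffNear (mdl 𝕜 S.dim) (mdl 𝕜 m) (Subtype.val : S.carrier → M) ⟨x, hxS⟩ :=
    S.isSmoothEmbedding.contMDiff.contMDiffNear _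
  have hsurj : Function.Surjective (mfderiv 𝓘(𝕜, Model 𝕜 R.objects.dim × Model 𝕜 (g - m))
      (mdl 𝕜 S.dim) (fun v => rS (G.tgt (ρ ((α.symm v.1 : M), v.2)))) v₀) := by
    obtain ⟨DrS, hDrS⟩ := hrS.exists_hasMFDerivAt
    obtain ⟨Dρ, hDρ⟩ := hρ.exists_hasMFDerivAt
    obtain ⟨Dκ, hDκ⟩ := hκ.exists_hasMFDerivAt
    obtain ⟨Db', hDb'⟩ := (hvL.comp_of_eq (.of_symm_mem_maximalAtlas hα (α.map_source hxα))
      hαx).exists_hasMFDerivAt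
    have hDfst : HasMFDerivAt 𝓘(𝕜, Model 𝕜 R.objects.dim × Model 𝕜 (g - m))
        (mdl 𝕜 R.objects.dim)
        (Prod.fst : Model 𝕜 R.objects.dim × Model 𝕜 (g - m) → Model 𝕜 R.objects.dim) v₀
        (ContinuousLinearMap.fst 𝕜 (Model 𝕜 R.objects.dim) (Model 𝕜 (g - m))) :=
      (ContinuousLinearMap.fst 𝕜 (Model 𝕜 R.objects.dim) (Model 𝕜 (g - m))).hasMFDerivAt
    have hDb := hDb'.comp_model hDfst rfl
    set Db := Db'.comp (ContinuousLinearMap.fst 𝕜 (Model 𝕜 R.objects.dim) (Model 𝕜 (g - m)))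
    obtain ⟨Dα, hDα⟩ := (ContMDiffNear.of_mem_maximalAtlas hα hxα).exists_hasMFDerivAt
    have hone := G.smooth_one.contMDiffNear x
    obtain ⟨Do, hDo⟩ := hone.exists_hasMFDerivAt
    let Dη : (Model 𝕜 R.objects.dim × Model 𝕜 (g - m)) →L[𝕜] Model 𝕜 S.dim :=
      mfderiv 𝓘(𝕜, Model 𝕜 R.objects.dim × Model 𝕜 (g - m))
        (mdl 𝕜 S.dim) (fun v => rS (G.tgt (ρ ((α.symm v.1 : M), v.2)))) v₀
    have hDη : HasMFDerivAt 𝓘(𝕜, Model 𝕜 R.objects.dim × Model 𝕜 (g - m)) (mdl 𝕜 S.dim)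
      (fun v => rS (G.tgt (ρ ((α.symm v.1 : M), v.2)))) v₀ Dη := hη.mdifferentiableAt.hasMFDerivAt
    let Dt : Model 𝕜 g →L[𝕜] Model 𝕜 m := mfderiv (mdl 𝕜 g) (mdl 𝕜 m) G.tgt (G.one x)
    have hDt : HasMFDerivAt (mdl 𝕜 g) (mdl 𝕜 m) G.tgt (G.one x) Dt :=
      ht.mdifferentiableAt.hasMFDerivAt
    let Ds : Model 𝕜 g →L[𝕜] Model 𝕜 m := mfderiv (mdl 𝕜 g) (mdl 𝕜 m) G.src (G.one x)
    have hDs : HasMFDerivAt (mdl 𝕜 g) (mdl 𝕜 m) G.src (G.one x) Ds :=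
      (G.src_submersion.contMDiff.contMDiffNear _).mdifferentiableAt.hasMFDerivAt
    let DS : Model 𝕜 S.dim →L[𝕜] Model 𝕜 m :=
      mfderiv (mdl 𝕜 S.dim) (mdl 𝕜 m) (Subtype.val : S.carrier → M) ⟨x, hxS⟩
    have hDS : HasMFDerivAt (mdl 𝕜 S.dim) (mdl 𝕜 m) (Subtype.val : S.carrier → M) ⟨x, hxS⟩ DS :=
      hvS.mdifferentiableAt.hasMFDerivAt
    let DL : Model 𝕜 R.objects.dim →L[𝕜] Model 𝕜 m :=
      mfderiv (mdl 𝕜 R.objects.dim) (mdl 𝕜 m) (Subtype.val : R.objects.carrier → M) xL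
    have hDL : HasMFDerivAt (mdl 𝕜 R.objects.dim) (mdl 𝕜 m)
      (Subtype.val : R.objects.carrier → M) xL DL := hvL.mdifferentiableAt.hasMFDerivAt
    have htrans : ∀ w, ∃ v a, Ds v = 0 ∧ Dt v + DL a = DS w := by
      intro w
      have h1 : (show TangentSpace (mdl 𝕜 m) x from DS w) ∈ S.tangent ⟨x, hxS⟩ := ⟨w, rfl⟩
      rw [hRS.transverse x hxL hxS] at h1
      obtain ⟨_, ⟨v, hv, rfl⟩, _, ⟨a, rfl⟩, h2⟩ := Submodule.mem_sup.1 h1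
      exact ⟨v, a, hv, h2⟩
    -- `DS` is injective
    have hinj : Function.Injective DS := by
      have h1 := hDrS.comp_model hDS rfl
      have h2 := h1.eq_of_eventuallyEq (hasMFDerivAt_id _) hrS'
      intro w w' hw
      have h3 := congrArg (fun A : Model 𝕜 S.dim →L[𝕜] Model 𝕜 S.dim => A w) h2
      have h4 := congrArg (fun A : Model 𝕜 S.dim →L[𝕜] Model 𝕜 S.dim => A w') h2
      have h3' : DrS (DS w) = w := h3
      have h4' : DrS (DS w') = w' := h4
      rw [← h3', ← h4', hw]
    -- the differential of `tgt ∘ ρ ∘ (α⁻¹ × id)`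
    let Dq := Dρ.comp (Db.prod (ContinuousLinearMap.snd 𝕜 (Model 𝕜 R.objects.dim)
      (Model 𝕜 (g - m))))
    have hDsnd : HasMFDerivAt 𝓘(𝕜, Model 𝕜 R.objects.dim × Model 𝕜 (g - m)) (mdl 𝕜 (g - m))
        (Prod.snd : Model 𝕜 R.objects.dim × Model 𝕜 (g - m) → Model 𝕜 (g - m)) v₀
        (ContinuousLinearMap.snd 𝕜 (Model 𝕜 R.objects.dim) (Model 𝕜 (g - m))) :=
      (ContinuousLinearMap.snd 𝕜 (Model 𝕜 R.objects.dim) (Model 𝕜 (g - m))).hasMFDerivAt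
    have hDh := hDt.comp_model (hDρ.comp_model (hDb.prodMk_model hDsnd) hbc0) hq0
    have hDSη : DS.comp Dη = Dt.comp Dq :=
      (hDS.comp_model hDη hη0).eq_of_eventuallyEq hDh hη'
    -- vectors of the form `Dt v`
    have hcase1 : ∀ v, Ds v = 0 → Dt (Dq (0, Dκ v)) = Dt v := by
      intro v hv
      -- Differentiating `ρ (src γ, κ γ) = γ` at the unit gives `Dρ (Ds v, Dκ v) = v`; a vector in
      -- the kernel of `Ds` is thus obtained by varying `c` alone.
      have h1 := hDρ.comp_model (hDs.prodMk_model hDκ) (by rw [G.src_one])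
      have h2 := h1.eq_of_eventuallyEq (hasMFDerivAt_id _) hρκ
      have h3 := congrArg (fun A : Model 𝕜 g →L[𝕜] Model 𝕜 g => A v) h2
      have h4 : Dρ (Ds v, Dκ v) = v := h3
      have h5 : Dq (0, Dκ v) = Dρ (Db' 0, Dκ v) := rfl
      rw [h5, map_zero, ← hv, h4]
    -- Vectors tangent to `L` come from moving along units: the point `(α y, κ (1_y))` parametrizes
    -- `1_y`, whose target is `y`.
    have hcase2 : ∀ a, ∃ u, Dt (Dq u) = DL a := by
      intro a
      have hi := hDα.prodMk_model (hDκ.comp_model (hDo.comp_model hDL rfl) rfl)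
      have h1 := hDh.comp_model hi rfl
      have h2 := h1.eq_of_eventuallyEq hDL (by
        have hρκ' : ∀ᶠ y : R.objects.carrier in 𝓝 xL,
            ρ (G.src (G.one y), κ (G.one y)) = G.one y :=
          ((G.smooth_one.continuous.comp continuous_subtype_val).continuousAt (x := xL)).eventually
            hρκ
        filter_upwards [hρκ', α.open_source.mem_nhds hxα] with y hy1 hy2
        rw [G.src_one] at hy1
        simp only [α.left_inv hy2, hy1, G.tgt_one])
      exact ⟨_, congrArg (fun A : Model 𝕜 R.objects.dim →L[𝕜] Model 𝕜 m => A a) h2⟩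
    intro w
    obtain ⟨v, a, hv, hva⟩ := htrans w
    obtain ⟨u, hu⟩ := hcase2 a
    refine ⟨(0, Dκ v) + u, hinj ?_⟩
    change DS (Dη ((0, Dκ v) + u)) = DS w
    have h1 : DS (Dη ((0, Dκ v) + u)) = Dt (Dq ((0, Dκ v) + u)) :=
      congrArg (fun A : (Model 𝕜 R.objects.dim × Model 𝕜 (g - m)) →L[𝕜] Model 𝕜 m =>
        A ((0, Dκ v) + u)) hDSη
    rw [h1, map_add Dq, map_add Dt, hcase1 v hv, hu, hva]
  obtain ⟨ξ, hξ, hξ0, hξ'⟩ := hη.exists_section hsurj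
  rw [hη0] at hξ hξ0 hξ'
  refine ⟨fun y => rP (ρ ((α.symm (ξ y).1 : M), (ξ y).2)), hqP.comp_of_eq hξ hξ0, ?_⟩
  have hc : Filter.Tendsto ξ (𝓝 ⟨x, hxS⟩) (𝓝 v₀) := by
    have := hξ.continuousAt
    rwa [ContinuousAt, hξ0] at this
  filter_upwards [hξ', hc.eventually hqP', hc.eventually hη'] with y h1 h2 h3
  rw [h2, ← h3, h1]

end LieSubgroupoid

end Groupoid

end

noncomputable section

variable {𝕜 : Type} [RCLike 𝕜]

/-! ### The diffeomorphism over `S`. -/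

section Groupoid

variable {g m : ℕ} {Γ M : Type*}
  [TopologicalSpace Γ] [ChartedSpace (Model 𝕜 g) Γ]
  [TopologicalSpace M] [ChartedSpace (Model 𝕜 m) M]

namespace LieSubgroupoid

variable {G : LieGroupoid 𝕜 g m Γ M} {R : LieSubgroupoid G} {S : EmbeddedSubmanifold 𝕜 m M}
  {n d : ℕ} [ChartedSpace (Model 𝕜 n) R.bundle] [ChartedSpace (Model 𝕜 d) R.Z]

/-- Every point of a stable subset whose orbits all meet `L` is the target of an arrow of `Γ_L`. -/
theorem exists_tgt_eq (hS : G.IsStable S.carrier) (hRS : R.IsIn S) {x : M} (hx : x ∈ S.carrier) :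
    ∃ γ : R.bundle, G.tgt γ = x := by
  refine mem_range_phi (hRS.meets x ?_)
  rintro _ ⟨γ, rfl, rfl⟩
  exact (hS γ).2 hx

/-- The map `Z(R) → M` has smooth local sections over `S`. -/
theorem exists_section_phi (hS : G.IsStable S.carrier) (hRS : R.IsIn S)
    (hP : Manifold.IsSmoothEmbedding (mdl 𝕜 n) (mdl 𝕜 g) ∞ (Subtype.val : R.bundle → Γ))
    (hp : Manifold.IsSubmersion (mdl 𝕜 n) (mdl 𝕜 d) ∞ R.proj) (x : S.carrier) :
    ∃ ζ : S.carrier → R.Z, ContMDiffAt (mdl 𝕜 S.dim) (mdl 𝕜 d) ∞ ζ x ∧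
      ∀ᶠ y in 𝓝 x, R.phi (ζ y) = y := by
  obtain ⟨γ, hγ⟩ := exists_tgt_eq hS hRS x.2
  have hmS : G.src γ ∈ S.carrier := by rw [← hS, hγ]; exact x.2
  -- Extend `γ` to a section `β` of the target; then `τ` supplies an arrow from `L` to the source of
  -- `β y`, and the product with `β y` lies in `Γ_L` and ends at `y`.
  obtain ⟨β, hβ, hβ0, hβ'⟩ := (G.tgt_submersion.isSubmersionAt (γ : Γ)).exists_section
  rw [hγ] at hβ hβ0 hβ'
  obtain ⟨r, hr, hr'⟩ := S.isSmoothEmbedding.exists_retraction ⟨G.src γ, hmS⟩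
  obtain ⟨τ, hτ, hτ'⟩ := exists_section_tgt hS hRS hP γ.2 hmS
  have hv : ContMDiffNear (mdl 𝕜 S.dim) (mdl 𝕜 m) (Subtype.val : S.carrier → M) x :=
    S.isSmoothEmbedding.contMDiff.contMDiffNear x
  have hβS : ContMDiffNear (mdl 𝕜 S.dim) (mdl 𝕜 g) (fun y : S.carrier => β y) x := hβ.comp hv
  have hs : ContMDiffNear (mdl 𝕜 S.dim) (mdl 𝕜 m) (fun y : S.carrier => G.src (β y)) x :=
    (G.src_submersion.contMDiff.contMDiffNear _).comp hβS
  have hs0 : G.src (β x) = G.src γ := by rw [hβ0]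
  have hy : ContMDiffNear (mdl 𝕜 S.dim) (mdl 𝕜 S.dim)
      (fun y : S.carrier => r (G.src (β y))) x := hr.comp_of_eq hs hs0
  have hy0 : r (G.src (β x)) = ⟨G.src γ, hmS⟩ := by rw [hs0]; exact hr'.self_of_nhds
  have hβt : ∀ᶠ y : S.carrier in 𝓝 x, G.tgt (β y) = y := hv.continuousAt.eventually hβ'
  have hy' : ∀ᶠ y : S.carrier in 𝓝 x, (r (G.src (β y)) : M) = G.src (β y) := by
    obtain ⟨W, hW, hWS⟩ := mem_nhds_induced _ _ _ |>.1 hr'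
    filter_upwards [hβt, hs.continuousAt.eventually (p := fun y => y ∈ W)
      (by beta_reduce; rw [hs0]; exact hW)] with y h1 h2
    have h3 : G.src (β y) ∈ S.carrier := by rw [← hS, h1]; exact y.2
    exact congrArg Subtype.val (hWS (a := ⟨_, h3⟩) h2)
  have hτy : ContMDiffNear (mdl 𝕜 S.dim) (mdl 𝕜 n)
      (fun y : S.carrier => τ (r (G.src (β y)))) x := hτ.comp_of_eq hy hy0
  have hcomp : ∀ᶠ y : S.carrier in 𝓝 x, G.tgt (τ (r (G.src (β y)))) = G.src (β y) := by
    have h1 := hy.continuousAt.eventually (p := fun y => G.tgt (τ y) = y)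
      (by beta_reduce; rw [hy0]; exact hτ')
    filter_upwards [h1, hy'] with y h2 h3
    rw [h2, h3]
  have hmul : ContMDiffNear (mdl 𝕜 S.dim) (mdl 𝕜 n)
      (fun y : S.carrier => R.mulR (τ (r (G.src (β y)))) (β y)) x := by
    refine hP.contMDiffNear_of_val (ContMDiffNear.congr (G.contMDiffNear_mul
      ((hP.contMDiff.contMDiffNear _).comp hτy) hβS hcomp) ?_)
    exact hcomp.mono fun y h => (coe_mulR h).symm
  refine ⟨fun y => R.proj (R.mulR (τ (r (G.src (β y)))) (β y)),
    hp.contMDiff.contMDiffAt.comp x hmul.contMDiffAt, ?_⟩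
  filter_upwards [hcomp, hβt] with y h1 h2
  rw [phi_proj, coe_mulR h1, G.tgt_mul _ _ h1, h2]

/-- The map `Z(R) → M` is a resolution of the closure of `S`. -/
theorem isResolution_phi [IsManifold (mdl 𝕜 d) ∞ R.Z]
    (hS : G.IsStable S.carrier) (hRS : R.IsFullIn S)
    (hP : Manifold.IsSmoothEmbedding (mdl 𝕜 n) (mdl 𝕜 g) ∞ (Subtype.val : R.bundle → Γ))
    (hp : Manifold.IsSubmersion (mdl 𝕜 n) (mdl 𝕜 d) ∞ R.proj) : IsResolution S d R.phi := by
  have hq : IsOpenQuotientMap R.proj := isOpenQuotientMap_proj hP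
  have hφ := contMDiff_phi hP hp
  have hopen := isOpen_phi_preimage hS hRS.isIn hq
  refine ⟨hφ, dense_phi_preimage hS hRS.isIn hq, hopen, ?_⟩
  let U : TopologicalSpace.Opens R.Z := ⟨R.phi ⁻¹' S.carrier, hopen⟩
  choose γ hγ using fun x : S.carrier => exists_tgt_eq hS hRS.isIn x.2
  let ψ : S.carrier → U := fun x => ⟨R.proj (γ x), by
    change G.tgt (γ x) ∈ S.carrier
    rw [hγ]; exact x.2⟩
  have hψ : ∀ x, R.phi (ψ x) = x := hγ
  refine ⟨⟨⟨fun z => ⟨R.phi z, z.2⟩, ψ, fun z => ?_, fun x => ?_⟩, ?_, ?_⟩, fun z => rfl⟩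
  · exact Subtype.ext (phi_injOn hS hRS (ψ _).2 z.2 (hψ _))
  · exact Subtype.ext (hψ x)
  · intro z
    exact S.isSmoothEmbedding.contMDiffWithinAt_of_val
      ((hφ.comp contMDiff_subtype_val z).contMDiffWithinAt (s := univ))
  · intro x
    let _ : ChartedSpace (Model 𝕜 d) ↥(U : Set R.Z) := inferInstanceAs (ChartedSpace _ U)
    have hU : Manifold.IsSmoothEmbedding (mdl 𝕜 d) (mdl 𝕜 d) ∞
      (Subtype.val : ↥(U : Set R.Z) → R.Z) := .of_opens U
    refine hU.contMDiffWithinAt_of_val (s := univ) ?_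
    -- The inverse `ψ` was chosen pointwise; injectivity of `φ` over `S` forces it to agree with the
    -- smooth section `ζ` near `x`.
    obtain ⟨ζ, hζ, hζ'⟩ := exists_section_phi hS hRS.isIn hP hp x
    refine ContMDiffAt.congr_of_eventuallyEq hζ ?_
    filter_upwards [hζ'] with y hy
    refine phi_injOn hS hRS (ψ y).2 ?_ ?_
    · change R.phi (ζ y) ∈ S.carrier
      rw [hy]; exact y.2
    · rw [hy]; exact hψ y

end LieSubgroupoid

end Groupoid

end

/-! ### Assembly. -/

theorem mainTheorem3 {𝕜 : Type} [RCLike 𝕜] {g m : ℕ} {Γ M : Type*}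
    [TopologicalSpace Γ] [ChartedSpace (Model 𝕜 g) Γ] [IsMfld 𝕜 g Γ]
    [TopologicalSpace M] [ChartedSpace (Model 𝕜 m) M] [IsMfld 𝕜 m M]
    (G : LieGroupoid 𝕜 g m Γ M)
    (S : EmbeddedSubmanifold 𝕜 m M) (hS : G.IsStable S.carrier)
    (R : LieSubgroupoid G) (hclosed : R.IsClosed) (hfull : R.IsFullIn S) :
    -- `Γ_L` is an embedded submanifold `P` of `Γ`, and `Z(R)` is a manifold for which the
    -- projection `Γ_L → Z(R)` is a submersion
    ∃ (P : EmbeddedSubmanifold 𝕜 g Γ) (hP : P.carrier = R.bundle)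
      (d : ℕ) (_ : ChartedSpace (Model 𝕜 d) R.Z),
      IsMfld 𝕜 d R.Z ∧
      Manifold.IsSubmersion (mdl 𝕜 P.dim) (mdl 𝕜 d) ∞
        (fun γ : P.carrier => R.proj ⟨γ.1, hP.subset γ.2⟩) ∧
      -- the target map descends to a unique map `φ`, which is smooth
      ∃ φ : R.Z → M,
        (∀ γ : R.bundle, φ (R.proj γ) = G.tgt γ.1) ∧
        (∀ ψ : R.Z → M, (∀ γ : R.bundle, ψ (R.proj γ) = G.tgt γ.1) → ψ = φ) ∧
        ContMDiff (mdl 𝕜 d) (mdl 𝕜 m) ∞ φ ∧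
        (∀ z, φ z ∈ closure S.carrier) ∧
        IsEquivariantResolution G S d φ ∧
        (R.IsSurjectiveIn S → range φ = closure S.carrier) ∧
        (R.IsProperIn S → IsProperMap φ) := by
  have := IsMfld.isManifold (𝕜 := 𝕜) (n := g) (X := Γ)
  have := IsMfld.isManifold (𝕜 := 𝕜) (n := m) (X := M)
  have := IsMfld.t2 (𝕜 := 𝕜) (n := m) (X := M)
  have := IsMfld.secondCountable (𝕜 := 𝕜) (n := g) (X := Γ)
  -- Needed to deduce properness from compactness of the preimages of compact sets.
  have : LocallyCompactSpace M := ChartedSpace.locallyCompactSpace (Model 𝕜 m) M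
  obtain ⟨n, _, _, hP⟩ := R.exists_isSmoothEmbedding_bundle
  obtain ⟨d, _, _, hp⟩ := LieSubgroupoid.exists_manifold_Z hP
  have hq := LieSubgroupoid.isOpenQuotientMap_proj hP
  have hφ := LieSubgroupoid.contMDiff_phi hP hp
  have hres := LieSubgroupoid.isResolution_phi hS hfull hP hp
  have hcl : ∀ z, R.phi z ∈ closure S.carrier := fun z =>
    map_mem_closure hφ.continuous (hres.dense z) fun _ h => h
  refine ⟨⟨R.bundle, n, inferInstance, inferInstance, hP⟩, rfl, d, inferInstance,
    ⟨inferInstance, ?_, ?_⟩, hp, R.phi, LieSubgroupoid.phi_proj, ?_, hφ, hcl,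
    ⟨hres, LieSubgroupoid.nonempty_rightModule R hP hp⟩, ?_, ?_⟩
  -- For an open quotient map, a closed relation is equivalent to a Hausdorff quotient.
  · exact (t2Space_iff_of_isOpenQuotientMap hq).2 (LieSubgroupoid.isClosed_proj_eq hclosed)
  · exact hq.isQuotientMap.secondCountableTopology hq.isOpenMap
  · intro ψ hψ
    funext z
    obtain ⟨γ, rfl⟩ := R.proj_surjective z
    exact hψ γ
  · intro hsurj
    refine Subset.antisymm (range_subset_iff.2 hcl) fun x hx => ?_
    obtain ⟨γ, hγ⟩ := LieSubgroupoid.mem_range_phi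
      (hsurj x (G.orbit_subset_closure hS hx))
    exact ⟨R.proj γ, hγ⟩
  · intro hprop
    exact isProperMap_iff_isCompact_preimage.2 ⟨hφ.continuous, fun K hK =>
      LieSubgroupoid.isCompact_phi_preimage hprop hcl hK⟩
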